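/- For an integer $n\ge 1$ let $A^{(n)}\in\{0,1\}^{n\times n}$ be the lower triangular all-ones matrix, $A^{(n)}_{i,j}=1$ iff $i\ge j$. For real matrices $B,C$ let $$\mathrm{MaxErr}(B,C)=\|B\|_{2\to\infty}\,\|C\|_{1\to2}=\sqrt{\max_i\sum_j B_{i,j}^2}\cdot\sqrt{\max_j\sum_i C_{i,j}^2},$$ and let $\mathsf{OptLTToe}(n)$ be the infimum of $\mathrm{MaxErr}(B,C)$ over all lower triangular Toeplitz matrices $B,C\in\mathbb{R}^{n\times n}$ with $BC=A^{(n)}$. A streaming algorithm is a program (with assignments of constants, addition, subtraction, multiplication, sequencing and while-loops that test whether a register is positive) over finitely many real-valued registers, initially $0$, with a one-way input stream of real numbers that cannot be rewound and a write-only output stream. Arithmetic is exact and each elementary operation takes one unit of time; the space is the number of registers plus the length of the program (which includes its real parameters). **Proposition.** There is an absolute constant $K$ with the following property. Let $m,\ell\ge1$, $n_1\ge5$ and $d\ge 2+\left(\frac{12+4\log n_1}{\pi}\right)^2$ be integers, and let $n=n_1^\ell$ and $n'=\frac{n_1^{\ell+1}-n_1}{n_1-1}$. Then there exist matrices $B\in\mathbb{R}^{n\times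 n'}$, $C\in\mathbb{R}^{n'\times n}$ and a streaming algorithm $\mathcal{A}$ such that: 1. (Valid factorization) $BC=A^{(n)}$. 2. (Near-optimality) $$\mathrm{MaxErr}(B,C)\le \ell\left(\sqrt{\mathsf{OptLTToe}(n_1)}+16\sqrt{n_1}\,\exp\!\left(-\tfrac{\pi}{2}\sqrt{d-2}\right)\right)^2,$$ where $$\mathsf{OptLTToe}(n_1)=1+\sum_{i=1}^{n_1-1}\left(2^{-2i}\binom{2i}{i}\right)^2\le 1+\frac{0.57722+\log n_1}{\pi}.$$ 3. (Valid algorithm) On input the rows of any $Z\in\mathbb{R}^{n'\times m}$, presented as a stream in some fixed order that does not depend on $Z$, each row being read once, $\mathcal{A}$ outputs the rows of $BZ\in\mathbb{R}^{n\times m}$ as a stream, in order. 4. (Efficiency) $\mathcal{A}$ uses space at most $K\ell d m$ and total time at most $K n d m$. -/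

import Mathlib

namespace ContinualCounting

noncomputable section

/-! ### Matrix factorizations of the all-ones lower triangular matrix -/

/-- The `n × n` lower triangular all-ones matrix `A^(n)`. -/
def allOnes (n : ℕ) : Matrix (Fin n) (Fin n) ℝ :=
  Matrix.of fun i j => if j ≤ i then 1 else 0

/-- The norm `‖B‖_{2 → ∞}`: the largest Euclidean norm of a row. -/
def maxRowNorm {a b : ℕ} (B : Matrix (Fin a) (Fin b) ℝ) : ℝ :=
  ⨆ i, √(∑ j, B i j ^ 2)

/-- The norm `‖C‖_{1 → 2}`: the largest Euclidean norm of a column. -/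
def maxColNorm {a b : ℕ} (C : Matrix (Fin a) (Fin b) ℝ) : ℝ :=
  ⨆ j, √(∑ i, C i j ^ 2)

/-- `MaxErr(B, C) = ‖B‖_{2 → ∞} ‖C‖_{1 → 2}`. -/
def maxErr {a b c : ℕ} (B : Matrix (Fin a) (Fin b) ℝ) (C : Matrix (Fin b) (Fin c) ℝ) : ℝ :=
  maxRowNorm B * maxColNorm C

/-- Lower triangular Toeplitz: `C i j = c (i - j)` for `j ≤ i`, and `0` above the diagonal. -/
def IsLTToeplitz {n : ℕ} (C : Matrix (Fin n) (Fin n) ℝ) : Prop :=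
  ∃ c : ℕ → ℝ, ∀ i j : Fin n, C i j = if j ≤ i then c ((i : ℕ) - (j : ℕ)) else 0

/-- The optimal value of `MaxErr` over all lower triangular Toeplitz factorizations of `A^(n)`. -/
def optLTToe (n : ℕ) : ℝ :=
  sInf {e : ℝ | ∃ B C : Matrix (Fin n) (Fin n) ℝ,
    IsLTToeplitz B ∧ IsLTToeplitz C ∧ B * C = allOnes n ∧ e = maxErr B C}

/-! ### Streaming algorithms with exact real arithmetic

A streaming algorithm is a structured program over real-valued registers. A real number occupies
one unit of memory and one arithmetic operation, comparison, input or output takes one unit of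
time. The input is a one-way stream of reals which cannot be rewound, and the output is a
write-only stream. -/

/-- Programs over real registers named by natural numbers. -/
inductive Prog : Type
  /-- do nothing -/
  | skip : Prog
  /-- `r := x` -/
  | const (r : ℕ) (x : ℝ) : Prog
  /-- `r := a + b` -/
  | add (r a b : ℕ) : Prog
  /-- `r := a - b` -/
  | sub (r a b : ℕ) : Prog
  /-- `r := a * b` -/
  | mul (r a b : ℕ) : Prog
  /-- remove the next number from the input stream and store it in `r` -/
  | read (r : ℕ) : Prog
  /-- append the content of `r` to the output stream -/
  | write (r : ℕ) : Prog
  /-- run `p`, then `q` -/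
  | seq (p q : Prog) : Prog
  /-- as long as the content of `r` is positive, run `p` -/
  | whilePos (r : ℕ) (p : Prog) : Prog

/-- The length of the program text. -/
def Prog.length : Prog → ℕ
  | .seq p q => p.length + q.length + 1
  | .whilePos _ p => p.length + 1
  | _ => 1

/-- The registers that the program mentions; execution touches no others. -/
def Prog.registers : Prog → Finset ℕ
  | .skip => ∅
  | .const r _ => {r}
  | .add r a b => {r, a, b}
  | .sub r a b => {r, a, b}
  | .mul r a b => {r, a, b}
  | .read r => {r}
  | .write r => {r}
  | .seq p q => p.registers ∪ q.registers
  | .whilePos r p => insert r p.registers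

/-- Space usage: the working registers (loop counters included) together with the memory that
holds the program and its real parameters. -/
def Prog.space (p : Prog) : ℕ := p.registers.card + p.length

/-- Register contents, the unread part of the input stream, and the output produced so far. -/
structure Config where
  regs : ℕ → ℝ
  input : List ℝ
  output : List ℝ

/-- Replace the content of register `r` by `x`. -/
def Config.set (c : Config) (r : ℕ) (x : ℝ) : Config :=
  { c with regs := Function.update c.regs r x }

/-- `Exec p c e t`: started in configuration `c`, the program `p` halts in configuration `e` after
exactly `t` steps. Reading from an exhausted input stream is not possible. -/
inductive Exec : Prog → Config → Config → ℕ → Prop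
  | skip (c : Config) : Exec .skip c c 1
  | const (r : ℕ) (x : ℝ) (c : Config) : Exec (.const r x) c (c.set r x) 1
  | add (r a b : ℕ) (c : Config) : Exec (.add r a b) c (c.set r (c.regs a + c.regs b)) 1
  | sub (r a b : ℕ) (c : Config) : Exec (.sub r a b) c (c.set r (c.regs a - c.regs b)) 1
  | mul (r a b : ℕ) (c : Config) : Exec (.mul r a b) c (c.set r (c.regs a * c.regs b)) 1
  | read (r : ℕ) (ρ : ℕ → ℝ) (z : ℝ) (inp out : List ℝ) :
      Exec (.read r) ⟨ρ, z :: inp, out⟩ ⟨Function.update ρ r z, inp, out⟩ 1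
  | write (r : ℕ) (ρ : ℕ → ℝ) (inp out : List ℝ) :
      Exec (.write r) ⟨ρ, inp, out⟩ ⟨ρ, inp, out ++ [ρ r]⟩ 1
  | seq {p q : Prog} {c₁ c₂ c₃ : Config} {s t : ℕ} :
      Exec p c₁ c₂ s → Exec q c₂ c₃ t → Exec (.seq p q) c₁ c₃ (s + t)
  | whileStop {r : ℕ} {p : Prog} {c : Config} :
      c.regs r ≤ 0 → Exec (.whilePos r p) c c 1
  | whileStep {r : ℕ} {p : Prog} {c₁ c₂ c₃ : Config} {s t : ℕ} :
      0 < c₁.regs r → Exec p c₁ c₂ s → Exec (.whilePos r p) c₂ c₃ t →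
      Exec (.whilePos r p) c₁ c₃ (s + t + 1)

/-- Started with all registers `0` on the input stream `inp`, the program reads the whole stream,
outputs the stream `out`, and halts after at most `T` steps. -/
def Prog.Produces (p : Prog) (inp out : List ℝ) (T : ℕ) : Prop :=
  ∃ (ρ : ℕ → ℝ) (t : ℕ), t ≤ T ∧ Exec p ⟨fun _ => 0, inp, []⟩ ⟨ρ, [], out⟩ t

/-- The stream of the rows `Z 0, Z 1, …` of a matrix, each row entry by entry. -/
def rowStream {a m : ℕ} (Z : Matrix (Fin a) (Fin m) ℝ) : List ℝ :=
  (List.finRange a).flatMap fun i => List.ofFn (Z i)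

end

end ContinualCounting

/-! Let F = (1-x)^(-1/2) = Σ f_i x^i, so that F² = 1/(1-x). Lower triangular Toeplitz matrices
multiply like power series modulo x^n, so F gives a Toeplitz square root of `allOnes n` with error
Σ_{i<n} f_i². Optimality is Landau's extremal problem (`landau_le`): with K the truncation of F and
K* its mirror, multiplication by K*/K does not increase energy, since K*/K is unimodular on the
circle and K has no zero in the closed disc. If bc agrees with F² to order n, the coefficient of
x^(n-1) in (K*/K)bc is Σ f_i², and Cauchy-Schwarz bounds it by the two energies. The logarithmic
bound comes from Wallis's product.

To compute with little memory, F is replaced by a nearby series b. The coefficients f_i are the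
arcsine moments (2/π)∫cos^{2i}. The range is cut into J dyadic intervals, with q Taylor terms of y^i
on each (`exists_taylor_approx`); the error 2^(-J) + (3/4)^q is uniform in i. The terms C(i,r)
t^(i-r) are impulse responses of chains of linear filters, so convolution with b needs Jq registers
per column. With J and q of order √d this is O(d) registers and an error exponentially small in √d.
A Neumann-type estimate (`exists_factor_of_approx`) shows that the complementary factor c =
1/((1-x)b) stays close to F too.

Finally the n₁ × n₁ factorization is composed with itself ℓ times. A prefix sum over n₁ blocks is
the sum over the completed blocks plus a prefix sum inside the current block. The first part is
handled by b and c at the block scale, the second by recursion. Each level adds one copy of the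
energies, hence the factor ℓ, and one filter bank, hence space O(ℓdm). The bank of a level runs only
once per block of that level, so the running times form a geometric series dominated by the lowest
level. -/

namespace ContinualCounting

open Finset

open scoped Polynomial

/-! ### The series of (1-x)^(-1/2) and the sum of its squared coefficients -/

/-- The coefficients `4⁻ⁱ * (2i choose i)` of the power series of `(1 - x)^(-1/2)`. -/
noncomputable def invSqrtCoeff (i : ℕ) : ℝ := (Nat.centralBinom i : ℝ) / 4 ^ i

theorem invSqrtCoeff_zero : invSqrtCoeff 0 = 1 := by simp [invSqrtCoeff]

theorem invSqrtCoeff_pos (i : ℕ) : 0 < invSqrtCoeff i := by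
  have := Nat.centralBinom_pos i
  unfold invSqrtCoeff
  positivity

theorem invSqrtCoeff_succ (i : ℕ) :
    invSqrtCoeff (i + 1) = invSqrtCoeff i * ((2 * i + 1) / (2 * i + 2)) := by
  have h : ((i + 1 : ℕ) : ℝ) * (Nat.centralBinom (i + 1) : ℝ)
      = 2 * (2 * i + 1) * (Nat.centralBinom i : ℝ) := by
    exact_mod_cast Nat.succ_mul_centralBinom_succ i
  have h1 : (i + 1 : ℝ) ≠ 0 := by positivity
  unfold invSqrtCoeff
  push_cast at h
  have h2 : (Nat.centralBinom (i + 1) : ℝ) = 2 * (2 * i + 1) * (Nat.centralBinom i : ℝ) / (i + 1) := by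
    field_simp; linarith
  rw [h2, pow_succ]
  field_simp
  ring

theorem invSqrtCoeff_succ_le (i : ℕ) : invSqrtCoeff (i + 1) ≤ invSqrtCoeff i := by
  rw [invSqrtCoeff_succ]
  refine mul_le_of_le_one_right (invSqrtCoeff_pos i).le ?_
  rw [div_le_one (by positivity)]
  linarith

theorem invSqrtCoeff_le_one (i : ℕ) : invSqrtCoeff i ≤ 1 := by
  have h := antitone_nat_of_succ_le invSqrtCoeff_succ_le (Nat.zero_le i)
  rwa [invSqrtCoeff_zero] at h

/-- The power series of `(1 - x)^(-1/2)`. -/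
noncomputable def invSqrtSeries : PowerSeries ℝ := PowerSeries.mk invSqrtCoeff

/-- The coefficient recursion is the differential equation 2(1-x)F' = F. It makes the derivative of
F²(1-x) vanish, and the constant term is 1. -/
theorem invSqrtSeries_sq : invSqrtSeries * invSqrtSeries * (1 - PowerSeries.X) = 1 := by
  have hode : 2 * (1 - PowerSeries.X) * PowerSeries.derivative ℝ invSqrtSeries = invSqrtSeries := by
    have h2 : (2 : PowerSeries ℝ) = PowerSeries.C (2 : ℝ) := (map_ofNat _ 2).symm
    ext i
    rw [h2, mul_assoc, PowerSeries.coeff_C_mul, sub_mul, one_mul, map_sub]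
    cases i with
    | zero =>
      simp [PowerSeries.coeff_derivative, invSqrtSeries, invSqrtCoeff_succ, invSqrtCoeff_zero,
        PowerSeries.coeff_zero_X_mul]
    | succ i =>
      rw [PowerSeries.coeff_succ_X_mul]
      simp only [PowerSeries.coeff_derivative, invSqrtSeries, PowerSeries.coeff_mk]
      rw [invSqrtCoeff_succ (i + 1)]
      push_cast
      have : (2 * ((i : ℝ) + 1) + 2) ≠ 0 := by positivity
      field_simp
      ring
  refine PowerSeries.derivative.ext (R := ℝ) ?_ ?_
  · simp only [Derivation.leibniz, map_sub, Derivation.map_one_eq_zero, smul_eq_mul,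
      PowerSeries.derivative_X]
    linear_combination invSqrtSeries * hode
  · simp [invSqrtSeries, invSqrtCoeff_zero]

/-- The power series of `1 / (1 - x)`. -/
noncomputable def onesSeries : PowerSeries ℝ := PowerSeries.mk 1

theorem onesSeries_mul : onesSeries * (1 - PowerSeries.X) = 1 :=
  PowerSeries.mk_one_mul_one_sub_eq_one ℝ

theorem invSqrtSeries_mul_self : invSqrtSeries * invSqrtSeries = onesSeries := by
  linear_combination onesSeries * invSqrtSeries_sq - invSqrtSeries * invSqrtSeries * onesSeries_mul

/-- `π k f_k² ≤ 1`, from the Wallis product. -/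
theorem invSqrtCoeff_sq_le (k : ℕ) (hk : 1 ≤ k) :
    invSqrtCoeff k ^ 2 ≤ 1 / (Real.pi * k) := by
  -- The product is constant in k because the Wallis factor cancels the squared ratio of consecutive
  -- coefficients; a lower bound for W_k then becomes an upper bound for f_k².
  have hW : ∀ k : ℕ, Real.Wallis.W k * (invSqrtCoeff k ^ 2 * (2 * k + 1)) = 1 := by
    intro k
    induction k with
    | zero => simp [Real.Wallis.W, invSqrtCoeff_zero]
    | succ k ih =>
      rw [Real.Wallis.W_succ, invSqrtCoeff_succ]
      refine Eq.trans ?_ ih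
      push_cast
      field_simp
      ring
  have h1 := Real.Wallis.le_W k
  have h2 := hW k
  have hk' : (1 : ℝ) ≤ k := by exact_mod_cast hk
  have hpi := Real.pi_pos
  rw [le_div_iff₀ (mul_pos hpi (by linarith))]
  have h3 : (2 * (k : ℝ) + 1) / (2 * k + 2) * (Real.pi / 2) * (invSqrtCoeff k ^ 2 * (2 * k + 1)) ≤ 1 := by
    exact (mul_le_mul_of_nonneg_right h1 (by positivity)).trans h2.le
  refine le_trans ?_ h3
  have h4 : invSqrtCoeff k ^ 2 * (Real.pi * k)
      = (invSqrtCoeff k ^ 2 * Real.pi) * k := by ring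
  have h5 : (2 * (k : ℝ) + 1) / (2 * k + 2) * (Real.pi / 2) * (invSqrtCoeff k ^ 2 * (2 * k + 1))
      = (invSqrtCoeff k ^ 2 * Real.pi) * ((2 * k + 1) ^ 2 / (4 * (k + 1))) := by
    field_simp; ring
  rw [h4, h5]
  refine mul_le_mul_of_nonneg_left ?_ (by positivity)
  rw [le_div_iff₀ (by positivity)]
  nlinarith

/-- The term i = 1 is kept at its exact value 1/4 and only the later ones are replaced by 1/(πi).
This saves (1 - π/4)/π, enough to use the crude bound 2/3 for Euler's constant in place of 0.57722.
-/
theorem sum_invSqrtCoeff_sq_le (n : ℕ) (hn : 2 ≤ n) :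
    ∑ i ∈ range n, invSqrtCoeff i ^ 2 ≤ 1 + (0.57722 + Real.log n) / Real.pi := by
  obtain ⟨k, rfl⟩ := Nat.exists_eq_add_of_le' hn
  have hpi := Real.pi_pos
  have h1 : ∑ i ∈ range (k + 2), invSqrtCoeff i ^ 2
      ≤ 1 + 1 / 4 + ((harmonic (k + 1) : ℝ) - 1) / Real.pi := by
    induction k with
    | zero =>
      simp [sum_range_succ, invSqrtCoeff, Nat.centralBinom, harmonic]
      norm_num [Nat.choose]
    | succ k ih =>
      rw [sum_range_succ, harmonic_succ]
      have := invSqrtCoeff_sq_le (k + 2) (by omega)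
      have h2 := ih (by omega)
      refine (add_le_add h2 this).trans (le_of_eq ?_)
      push_cast
      field_simp
      ring
  have h2 := (Real.eulerMascheroniSeq_lt_eulerMascheroniConstant (k + 1)).trans
    Real.eulerMascheroniConstant_lt_two_thirds
  unfold Real.eulerMascheroniSeq at h2
  have h3 : ((k + 1 : ℕ) : ℝ) + 1 = ((k + 2 : ℕ) : ℝ) := by push_cast; ring
  rw [h3] at h2
  refine h1.trans ?_
  have h4 : (1 : ℝ) / 4 = (Real.pi / 4) / Real.pi := by field_simp
  rw [add_assoc, h4, ← add_div]
  have := Real.pi_lt_d2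
  refine add_le_add_right (div_le_div_of_nonneg_right ?_ hpi.le) _
  linarith

/-! ### Landau's extremal problem -/

/-- The `ℓ¹` norm of the first `n` coefficients. -/
noncomputable def l1Norm (n : ℕ) (a : PowerSeries ℝ) : ℝ := ∑ i ∈ range n, |a.coeff i|

/-- The squared `ℓ²` norm of the first `n` coefficients. -/
noncomputable def l2NormSq (n : ℕ) (a : PowerSeries ℝ) : ℝ := ∑ i ∈ range n, a.coeff i ^ 2

theorem l1Norm_nonneg (n : ℕ) (a : PowerSeries ℝ) : 0 ≤ l1Norm n a :=
  sum_nonneg fun _ _ => abs_nonneg _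

theorem l2NormSq_nonneg (n : ℕ) (a : PowerSeries ℝ) : 0 ≤ l2NormSq n a :=
  sum_nonneg fun _ _ => sq_nonneg _

theorem l1Norm_mul_le (n : ℕ) (a b : PowerSeries ℝ) :
    l1Norm n (a * b) ≤ l1Norm n a * l1Norm n b := by
  unfold l1Norm
  calc ∑ k ∈ range n, |(a * b).coeff k|
      ≤ ∑ k ∈ range n, ∑ x ∈ antidiagonal k, |a.coeff x.1| * |b.coeff x.2| := by
        refine sum_le_sum fun k _ => ?_
        rw [PowerSeries.coeff_mul]
        refine (abs_sum_le_sum_abs _ _).trans (le_of_eq ?_)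
        simp only [abs_mul]
    _ = ∑ y ∈ (range n).sigma fun k => antidiagonal k, |a.coeff y.2.1| * |b.coeff y.2.2| := by
        rw [sum_sigma]
    _ = ∑ x ∈ ((range n).sigma fun k => antidiagonal k).image (fun y => y.2),
          |a.coeff x.1| * |b.coeff x.2| := by
        rw [sum_image]
        rintro ⟨k, x⟩ hx ⟨k', x'⟩ hx' h
        simp only [coe_sigma, Set.mem_sigma_iff, mem_coe, HasAntidiagonal.mem_antidiagonal] at hx hx' h
        subst h
        obtain rfl : k = k' := by rw [← hx.2, hx'.2]
        rfl
    _ ≤ ∑ x ∈ range n ×ˢ range n, |a.coeff x.1| * |b.coeff x.2| := by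
        refine sum_le_sum_of_subset_of_nonneg ?_ fun _ _ _ => by positivity
        intro x hx
        simp only [mem_image, mem_sigma, mem_range, HasAntidiagonal.mem_antidiagonal] at hx
        obtain ⟨y, ⟨h1, h2⟩, rfl⟩ := hx
        simp only [mem_product, mem_range]
        omega
    _ = _ := by rw [sum_product, sum_mul_sum]

theorem coeff_mul_congr {n : ℕ} (x : PowerSeries ℝ) {a b : PowerSeries ℝ}
    (h : ∀ k < n, a.coeff k = b.coeff k) {k : ℕ} (hk : k < n) :
    (x * a).coeff k = (x * b).coeff k := by
  rw [PowerSeries.coeff_mul, PowerSeries.coeff_mul]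
  refine sum_congr rfl fun y hy => ?_
  rw [HasAntidiagonal.mem_antidiagonal] at hy
  rw [h _ (by omega)]

theorem coeff_mul_congr_left {n : ℕ} (x : PowerSeries ℝ) {a b : PowerSeries ℝ}
    (h : ∀ k < n, a.coeff k = b.coeff k) {k : ℕ} (hk : k < n) :
    (a * x).coeff k = (b * x).coeff k := by
  rw [mul_comm a, mul_comm b]
  exact coeff_mul_congr x h hk

/-- Neumann-series estimate: solve for cg = (c-q)g + qg and absorb the last term. It is uniform in
L, so it gives summability of g when Q < c. -/
theorem l1Norm_le_of_const_sub_mul {c Q : ℝ} {q g : PowerSeries ℝ} {L : ℕ}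
    (hc : 0 ≤ c) (hQ : l1Norm L q ≤ Q) :
    (c - Q) * l1Norm L g ≤ l1Norm L ((PowerSeries.C c - q) * g) := by
  have h1 : c * l1Norm L g ≤ l1Norm L ((PowerSeries.C c - q) * g) + l1Norm L (q * g) := by
    unfold l1Norm
    rw [mul_sum, ← sum_add_distrib]
    refine sum_le_sum fun k _ => ?_
    have h2 : c * g.coeff k = ((PowerSeries.C c - q) * g).coeff k + (q * g).coeff k := by
      rw [← map_add, ← PowerSeries.coeff_C_mul]
      congr 1
      ring
    calc c * |g.coeff k| = |c * g.coeff k| := by rw [abs_mul, abs_of_nonneg hc]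
      _ ≤ _ := by rw [h2]; exact abs_add_le _ _
  have h3 := (l1Norm_mul_le L q g).trans (mul_le_mul_of_nonneg_right hQ (l1Norm_nonneg L g))
  linarith

/-- The energy of P is a single coefficient of P · P.mirror. For P = A.mirror · G and P = A · G this
product is the same polynomial; it is the algebraic form of |A.mirror| = |A| on the unit circle. -/
theorem mirror_mul_sum_sq (A G : ℝ[X]) :
    ((A.mirror * G).sum fun _ => (· ^ 2)) = (A * G).sum fun _ => (· ^ 2) := by
  by_cases hA : A = 0
  · simp [hA]
  by_cases hG : G = 0
  · simp [hG]
  have hA' : A.mirror ≠ 0 := by rwa [Ne, Polynomial.mirror_eq_zero]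
  rw [← Polynomial.coeff_mul_mirror, ← Polynomial.coeff_mul_mirror,
    Polynomial.mirror_mul_of_domain, Polynomial.mirror_mul_of_domain, Polynomial.mirror_mirror,
    Polynomial.natDegree_mul hA' hG, Polynomial.natDegree_mul hA hG,
    Polynomial.natTrailingDegree_mul hA' hG, Polynomial.natTrailingDegree_mul hA hG,
    Polynomial.mirror_natDegree, Polynomial.mirror_natTrailingDegree]
  congr 1
  ring

theorem sum_sq_eq_l2NormSq (A : ℝ[X]) (L : ℕ) (hL : A.natDegree < L) :
    (A.sum fun _ => (· ^ 2)) = l2NormSq L A := by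
  rw [Polynomial.sum_over_range' A (fun _ => by simp) L hL]
  simp [l2NormSq]

theorem l2NormSq_le_sum_sq (A : ℝ[X]) (n : ℕ) :
    l2NormSq n A ≤ A.sum fun _ => (· ^ 2) := by
  rw [sum_sq_eq_l2NormSq A (max n (A.natDegree + 1)) (by omega)]
  exact sum_le_sum_of_subset_of_nonneg (range_mono (le_max_left _ _)) fun _ _ _ => sq_nonneg _

theorem sum_sq_le_l1Norm_sq (n : ℕ) (a : PowerSeries ℝ) : l2NormSq n a ≤ l1Norm n a ^ 2 := by
  unfold l2NormSq l1Norm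
  simp only [← sq_abs (PowerSeries.coeff _ a)]
  exact sum_sq_le_sq_sum_of_nonneg fun _ _ => abs_nonneg _

/-- Multiplication by `K.mirror / K` does not increase energy, as soon as `1 / K` is summable. -/
theorem l2NormSq_mirror_mul_le (K : ℝ[X]) (n : ℕ) (b g : PowerSeries ℝ)
    (hb : ∀ k, n ≤ k → b.coeff k = 0) (hg : (K : PowerSeries ℝ) * g = b)
    (M : ℝ) (hM : ∀ L, l1Norm L g ≤ M) :
    l2NormSq n ((K.mirror : ℝ[X]) * g) ≤ l2NormSq n b := by
  have hsum : Summable fun j => |g.coeff j| :=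
    summable_of_sum_range_le (fun _ => abs_nonneg _) hM
  set κ := l1Norm (K.natDegree + 1) K with hκ
  have hK : ∀ L, l1Norm L K ≤ κ := by
    intro L
    have h0 : ∀ i, K.natDegree + 1 ≤ i → |(K : PowerSeries ℝ).coeff i| = 0 := by
      intro i hi
      rw [Polynomial.coeff_coe, Polynomial.coeff_eq_zero_of_natDegree_lt (by omega), abs_zero]
    rw [hκ]
    unfold l1Norm
    rcases le_total L (K.natDegree + 1) with h | h
    · exact sum_le_sum_of_subset_of_nonneg (range_mono h) fun _ _ _ => abs_nonneg _
    · refine (sum_subset (range_mono h) fun i _ hi => h0 i ?_).ge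
      simpa using hi
  have hκ0 : 0 ≤ κ := l1Norm_nonneg _ _
  refine le_of_forall_pos_le_add fun ε hε => ?_
  -- The mirror identity needs polynomials, so g is cut at N with tail below δ; the tail, multiplied
  -- by K, costs at most (κδ)² ≤ ε in energy.
  obtain ⟨δ, hδ, hδε⟩ : ∃ δ : ℝ, 0 < δ ∧ (κ * δ) ^ 2 ≤ ε := by
    refine ⟨√ε / (κ + 1), by positivity, ?_⟩
    have h1 : κ * (√ε / (κ + 1)) ≤ √ε := by
      rw [mul_div_assoc', div_le_iff₀ (by positivity)]
      nlinarith [Real.sqrt_nonneg ε]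
    calc _ ≤ √ε ^ 2 := pow_le_pow_left₀ (by positivity) h1 2
      _ = ε := Real.sq_sqrt hε.le
  obtain ⟨N, hnN, hN⟩ : ∃ N, n ≤ N ∧ ∑' j, |g.coeff (j + N)| < δ := by
    have := (tendsto_sum_nat_add fun j => |g.coeff j|).eventually (gt_mem_nhds hδ)
    obtain ⟨N, h⟩ := (this.and (Filter.eventually_ge_atTop n)).exists
    exact ⟨N, h.2, h.1⟩
  set G : ℝ[X] := PowerSeries.trunc N g with hG
  have hGc : ∀ k < N, (G : PowerSeries ℝ).coeff k = g.coeff k := by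
    intro k hk
    rw [Polynomial.coeff_coe, hG, PowerSeries.coeff_trunc, if_pos hk]
  have hT : ∀ L, l1Norm L (g - G) ≤ δ := by
    intro L
    have h1 : ∀ j, |(g - (G : PowerSeries ℝ)).coeff j| = if j < N then 0 else |g.coeff j| := by
      intro j
      rw [map_sub, Polynomial.coeff_coe, hG, PowerSeries.coeff_trunc]
      split_ifs <;> simp
    calc l1Norm L (g - G) ≤ l1Norm (N + L) (g - G) :=
          sum_le_sum_of_subset_of_nonneg (range_mono (by omega)) fun _ _ _ => abs_nonneg _
      _ = ∑ j ∈ range L, |g.coeff (j + N)| := by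
          unfold l1Norm
          rw [sum_range_add, sum_eq_zero, zero_add]
          · refine sum_congr rfl fun j _ => ?_
            rw [h1, if_neg (by omega), add_comm]
          · intro j hj
            rw [h1, if_pos (by simpa using hj)]
      _ ≤ ∑' j, |g.coeff (j + N)| :=
          ((summable_nat_add_iff N).2 hsum).sum_le_tsum _ fun _ _ => abs_nonneg _
      _ ≤ δ := hN.le
  calc l2NormSq n ((K.mirror : ℝ[X]) * g)
      = l2NormSq n ((K.mirror * G : ℝ[X]) : PowerSeries ℝ) := by
        unfold l2NormSq
        refine sum_congr rfl fun k hk => ?_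
        rw [mem_range] at hk
        rw [Polynomial.coe_mul, coeff_mul_congr _ hGc (by omega)]
    _ ≤ (K.mirror * G).sum fun _ => (· ^ 2) := l2NormSq_le_sum_sq _ _
    _ = (K * G).sum fun _ => (· ^ 2) := mirror_mul_sum_sq K G
    _ = l2NormSq (n + ((K * G).natDegree + 1)) ((K * G : ℝ[X]) : PowerSeries ℝ) :=
        sum_sq_eq_l2NormSq _ _ (by omega)
    _ ≤ l2NormSq n b + l2NormSq (n + ((K * G).natDegree + 1)) (K * (g - G)) := by
        unfold l2NormSq
        rw [sum_range_add, sum_range_add _ n]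
        have h1 : ∀ k < n, ((K * G : ℝ[X]) : PowerSeries ℝ).coeff k = b.coeff k := by
          intro k hk
          rw [Polynomial.coe_mul, coeff_mul_congr _ hGc (by omega), hg]
        -- Here Kg = b vanishes, so K·G = -K(g - G): all energy of K·G beyond n comes from the
        -- cut-off tail.
        have h2 : ∀ k, n ≤ k → ((K * G : ℝ[X]) : PowerSeries ℝ).coeff k ^ 2
            = ((K : PowerSeries ℝ) * (g - G)).coeff k ^ 2 := by
          intro k hk
          rw [mul_sub, hg, map_sub, hb k hk, Polynomial.coe_mul]
          ring
        rw [sum_congr rfl fun k hk => by rw [h1 k (mem_range.1 hk)],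
          sum_congr rfl fun k _ => h2 (n + k) (by omega)]
        have : 0 ≤ ∑ x ∈ range n, ((K : PowerSeries ℝ) * (g - G)).coeff x ^ 2 :=
          sum_nonneg fun _ _ => sq_nonneg _
        linarith
    _ ≤ l2NormSq n b + ε := by
        refine add_le_add_right ((sum_sq_le_l1Norm_sq _ _).trans (le_trans ?_ hδε)) _
        refine pow_le_pow_left₀ (l1Norm_nonneg _ _) ?_ 2
        exact (l1Norm_mul_le _ _ _).trans
          (mul_le_mul (hK _) (hT _) (l1Norm_nonneg _ _) hκ0)

/-- The truncation of `(1 - x)^(-1/2)` to a polynomial of degree less than `n`. -/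
noncomputable def invSqrtPoly (n : ℕ) : ℝ[X] := PowerSeries.trunc n invSqrtSeries

theorem coeff_invSqrtPoly (n i : ℕ) :
    (invSqrtPoly n).coeff i = if i < n then invSqrtCoeff i else 0 := by
  rw [invSqrtPoly, PowerSeries.coeff_trunc, invSqrtSeries, PowerSeries.coeff_mk]

theorem natDegree_invSqrtPoly (n : ℕ) : (invSqrtPoly (n + 1)).natDegree = n := by
  refine Polynomial.natDegree_eq_of_le_of_coeff_ne_zero ?_ ?_
  · rw [Polynomial.natDegree_le_iff_coeff_eq_zero]
    intro N hN
    rw [coeff_invSqrtPoly, if_neg (by omega)]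
  · rw [coeff_invSqrtPoly, if_pos (by omega)]
    exact (invSqrtCoeff_pos n).ne'

theorem coeff_mirror_invSqrtPoly (n i : ℕ) (hi : i ≤ n) :
    (invSqrtPoly (n + 1)).mirror.coeff i = invSqrtCoeff (n - i) := by
  have h0 : (invSqrtPoly (n + 1)).natTrailingDegree = 0 := by
    refine Polynomial.natTrailingDegree_eq_zero.2 (Or.inr ?_)
    rw [coeff_invSqrtPoly, if_pos (by omega)]
    exact (invSqrtCoeff_pos 0).ne'
  rw [Polynomial.coeff_mirror, natDegree_invSqrtPoly, h0, add_zero, Polynomial.revAt_le hi,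
    coeff_invSqrtPoly, if_pos (by omega)]

/-- The reciprocal of the truncated series is absolutely summable after multiplication by a
polynomial: the truncation has no zeros in the closed unit disc. -/
theorem l1Norm_le_of_invSqrtPoly_mul (n : ℕ) (g b : PowerSeries ℝ)
    (hb : ∀ k, n + 1 ≤ k → b.coeff k = 0) (hg : (invSqrtPoly (n + 1) : PowerSeries ℝ) * g = b) :
    ∃ M, ∀ L, l1Norm L g ≤ M := by
  set K : PowerSeries ℝ := (invSqrtPoly (n + 1) : PowerSeries ℝ) with hK
  have hKc : ∀ i, K.coeff i = if i < n + 1 then invSqrtCoeff i else 0 := fun i => by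
    rw [hK, Polynomial.coeff_coe, coeff_invSqrtPoly]
  -- Eneström-Kakeya: r is at least every ratio f_{i+1}/f_i with i ≤ n, so (1 - rx)K = 1 - q where q
  -- has nonnegative coefficients and no constant term. Their sum telescopes to at most r < 1, since
  -- the coefficients of K sum to at least 1.
  set r : ℝ := (2 * n + 1) / (2 * n + 2) with hr
  have hr0 : 0 ≤ r := by positivity
  have hr1 : r < 1 := by
    rw [hr, div_lt_one (by positivity)]
    linarith
  set q : PowerSeries ℝ := PowerSeries.C 1 - (1 - PowerSeries.C r * PowerSeries.X) * K with hq
  have hq0 : q.coeff 0 = 0 := by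
    have h2 : (PowerSeries.C r * PowerSeries.X * K).coeff 0 = 0 := by
      rw [mul_assoc, PowerSeries.coeff_C_mul, PowerSeries.coeff_zero_X_mul, mul_zero]
    rw [hq, sub_mul, one_mul, map_sub, map_sub, h2, hKc, PowerSeries.coeff_zero_C]
    simp [invSqrtCoeff_zero]
  have hq1 : ∀ i, q.coeff (i + 1) = r * K.coeff i - K.coeff (i + 1) := by
    intro i
    have h2 : (PowerSeries.C r * PowerSeries.X * K).coeff (i + 1) = r * K.coeff i := by
      rw [mul_assoc, PowerSeries.coeff_C_mul, PowerSeries.coeff_succ_X_mul]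
    rw [hq, sub_mul, one_mul, map_sub, map_sub, h2, PowerSeries.coeff_C, if_neg (by omega)]
    ring
  have hK0 : ∀ i, 0 ≤ K.coeff i := by
    intro i
    rw [hKc]
    split_ifs
    exacts [(invSqrtCoeff_pos i).le, le_rfl]
  have hqn : ∀ i, 0 ≤ q.coeff (i + 1) := by
    intro i
    rw [hq1]
    by_cases hi : i + 1 < n + 1
    · rw [hKc, hKc, if_pos hi, if_pos (by omega), invSqrtCoeff_succ, sub_nonneg, mul_comm]
      refine mul_le_mul_of_nonneg_right ?_ (invSqrtCoeff_pos i).le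
      rw [hr, div_le_div_iff₀ (by positivity) (by positivity)]
      have : (i : ℝ) ≤ n := by exact_mod_cast (by omega : i ≤ n)
      nlinarith
    · rw [hKc (i + 1), if_neg hi, sub_zero]
      exact mul_nonneg hr0 (hK0 i)
  have hQ : ∀ L, l1Norm L q ≤ r := by
    intro L
    have h1 : ∀ L, l1Norm (L + 2) q ≤ r := by
      intro L
      unfold l1Norm
      rw [sum_range_succ', hq0, abs_zero, add_zero,
        sum_congr rfl fun i _ => abs_of_nonneg (hqn i), sum_congr rfl fun i _ => hq1 i,
        sum_sub_distrib, ← mul_sum]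
      have h2 := sum_range_succ' (fun i => K.coeff i) (L + 1)
      rw [sum_range_succ] at h2
      have h3 : K.coeff 0 = 1 := by rw [hKc, if_pos (by omega), invSqrtCoeff_zero]
      have h4 : 1 ≤ ∑ i ∈ range (L + 1), K.coeff i := by
        rw [← h3]
        exact single_le_sum (f := fun i => K.coeff i) (fun i _ => hK0 i) (by simp)
      have h5 := hK0 (L + 1)
      nlinarith
    refine le_trans ?_ (h1 L)
    exact sum_le_sum_of_subset_of_nonneg (range_mono (by omega)) fun _ _ _ => abs_nonneg _
  have hKq : (PowerSeries.C 1 - q) * g = (1 - PowerSeries.C r * PowerSeries.X) * b := by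
    rw [hq, sub_sub_cancel, mul_assoc, hg]
  have hE : ∀ L, l1Norm L ((1 - PowerSeries.C r * PowerSeries.X) * b)
      ≤ (1 + r) * l1Norm (n + 1) b := by
    intro L
    have h1 : l1Norm L (1 - PowerSeries.C r * PowerSeries.X : PowerSeries ℝ) ≤ 1 + r := by
      have h0 : l1Norm (L + 2) (1 - PowerSeries.C r * PowerSeries.X : PowerSeries ℝ) ≤ 1 + r := by
        unfold l1Norm
        rw [sum_range_succ', sum_range_succ', sum_eq_zero]
        · simp [PowerSeries.coeff_one, abs_of_nonneg hr0]
          linarith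
        · intro i _
          simp [PowerSeries.coeff_one]
      refine le_trans ?_ h0
      exact sum_le_sum_of_subset_of_nonneg (range_mono (by omega)) fun _ _ _ => abs_nonneg _
    have h2 : l1Norm L b ≤ l1Norm (n + 1) b := by
      unfold l1Norm
      rcases le_total L (n + 1) with h | h
      · exact sum_le_sum_of_subset_of_nonneg (range_mono h) fun _ _ _ => abs_nonneg _
      · refine (sum_subset (range_mono h) fun i _ hi => ?_).ge
        rw [hb i (by simpa using hi), abs_zero]
    exact (l1Norm_mul_le _ _ _).trans (mul_le_mul h1 h2 (l1Norm_nonneg _ _) (by positivity))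
  refine ⟨(1 + r) * l1Norm (n + 1) b / (1 - r), fun L => ?_⟩
  rw [le_div_iff₀ (by linarith), mul_comm]
  refine (l1Norm_le_of_const_sub_mul zero_le_one (hQ L)).trans ?_
  rw [hKq]
  exact hE L

/-- Landau's extremal problem: the energies of two factors of `1 + x + ⋯ + xⁿ + ⋯`. -/
theorem landau_le (n : ℕ) (b c : PowerSeries ℝ)
    (hbc : ∀ k < n + 1, (b * c).coeff k = 1) :
    ∑ i ∈ range (n + 1), invSqrtCoeff i ^ 2 ≤ √(l2NormSq (n + 1) b) * √(l2NormSq (n + 1) c) := by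
  set K : PowerSeries ℝ := (invSqrtPoly (n + 1) : PowerSeries ℝ) with hK
  have hKF : ∀ k < n + 1, K.coeff k = invSqrtSeries.coeff k := by
    intro k hk
    rw [hK, Polynomial.coeff_coe, coeff_invSqrtPoly, if_pos hk, invSqrtSeries, PowerSeries.coeff_mk]
  have hK0 : PowerSeries.constantCoeff K ≠ 0 := by
    rw [← PowerSeries.coeff_zero_eq_constantCoeff_apply, hKF 0 (by omega)]
    simp [invSqrtSeries, invSqrtCoeff_zero]
  have hKinv : K * K⁻¹ = 1 := PowerSeries.mul_inv_cancel K hK0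
  set Km : PowerSeries ℝ := ((invSqrtPoly (n + 1)).mirror : PowerSeries ℝ) with hKm
  -- Only coefficients up to n matter below; truncating b makes K⁻¹b' summable, as the energy lemma
  -- requires.
  set b' : PowerSeries ℝ := ((PowerSeries.trunc (n + 1) b : ℝ[X]) : PowerSeries ℝ) with hb'
  have hb'c : ∀ k, b'.coeff k = if k < n + 1 then b.coeff k else 0 := by
    intro k
    rw [hb', Polynomial.coeff_coe, PowerSeries.coeff_trunc]
  have hb'0 : ∀ k, n + 1 ≤ k → b'.coeff k = 0 := fun k hk => by rw [hb'c, if_neg (by omega)]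
  have hg : K * (K⁻¹ * b') = b' := by rw [← mul_assoc, hKinv, one_mul]
  obtain ⟨M, hM⟩ := l1Norm_le_of_invSqrtPoly_mul n (K⁻¹ * b') b' hb'0 hg
  have hcontr := l2NormSq_mirror_mul_le (invSqrtPoly (n + 1)) (n + 1) b' (K⁻¹ * b') hb'0 hg M hM
  rw [← hKm] at hcontr
  have hb'b : l2NormSq (n + 1) b' = l2NormSq (n + 1) b := by
    refine sum_congr rfl fun k hk => ?_
    rw [hb'c, if_pos (by simpa using hk)]
  have hagree : ∀ k < n + 1, (Km * (K⁻¹ * b')).coeff k = (Km * (K⁻¹ * b)).coeff k := by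
    intro k hk
    refine coeff_mul_congr _ (fun k hk => coeff_mul_congr _ (fun k hk => ?_) hk) hk
    rw [hb'c, if_pos hk]
  -- Modulo x^(n+1), bc = F² = KF, so (K*/K)bc = K*F. Its n-th coefficient pairs f_{n-i} with
  -- f_{n-i}, giving the sum of squares.
  have hval : (Km * (K⁻¹ * b) * c).coeff n = ∑ i ∈ range (n + 1), invSqrtCoeff i ^ 2 := by
    have h1 : Km * (K⁻¹ * b) * c = Km * K⁻¹ * (b * c) := by ring
    have h2 : ∀ k < n + 1, (b * c).coeff k = (invSqrtSeries * invSqrtSeries).coeff k := by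
      intro k hk
      rw [hbc k hk, invSqrtSeries_mul_self, onesSeries, PowerSeries.coeff_mk, Pi.one_apply]
    have h3 : ∀ k < n + 1, (invSqrtSeries * invSqrtSeries).coeff k = (K * invSqrtSeries).coeff k :=
      fun k hk => coeff_mul_congr_left _ (fun k hk => (hKF k hk).symm) hk
    rw [h1, coeff_mul_congr _ h2 (Nat.lt_succ_self n), coeff_mul_congr _ h3 (Nat.lt_succ_self n)]
    have h4 : Km * K⁻¹ * (K * invSqrtSeries) = Km * invSqrtSeries := by
      linear_combination Km * invSqrtSeries * hKinv
    rw [h4, PowerSeries.coeff_mul, Finset.Nat.sum_antidiagonal_eq_sum_range_succ_mk,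
      ← sum_range_reflect]
    refine sum_congr rfl fun k hk => ?_
    rw [mem_range] at hk
    rw [hKm, Polynomial.coeff_coe, coeff_mirror_invSqrtPoly _ _ (by omega), invSqrtSeries,
      PowerSeries.coeff_mk, sq]
    congr 2 <;> omega
  rw [← hval, PowerSeries.coeff_mul, Finset.Nat.sum_antidiagonal_eq_sum_range_succ_mk]
  refine (Real.sum_mul_le_sqrt_mul_sqrt _ _ _).trans ?_
  refine mul_le_mul (Real.sqrt_le_sqrt ?_) (le_of_eq ?_) (Real.sqrt_nonneg _) (Real.sqrt_nonneg _)
  · refine le_trans (le_of_eq ?_) (hcontr.trans hb'b.le)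
    refine sum_congr rfl fun k hk => ?_
    rw [hagree k (by simpa using hk)]
  · congr 1
    rw [l2NormSq, ← sum_range_reflect]
    refine sum_congr rfl fun k hk => ?_
    rw [mem_range] at hk
    congr 3
    dsimp only
    omega

/-! ### Toeplitz matrices and the optimal Toeplitz error -/

/-- The lower triangular Toeplitz matrix with the given coefficients. -/
noncomputable def toeplitz (n : ℕ) (c : PowerSeries ℝ) : Matrix (Fin n) (Fin n) ℝ :=
  Matrix.of fun i j => if j ≤ i then c.coeff ((i : ℕ) - j) else 0

/-- The length a is kept apart from the row index: a = i + 1 gives the ordinary Toeplitz product,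
while a = i gives the strictly lower version needed for completed blocks in the recursion. -/
theorem sum_truncated_mul (p a j : ℕ) (ha : a ≤ p) (b c : PowerSeries ℝ) :
    ∑ m ∈ range p, (if m < a then b.coeff (a - 1 - m) else 0) *
      (if j ≤ m then c.coeff (m - j) else 0) = if j < a then (b * c).coeff (a - 1 - j) else 0 := by
  have h1 : ∑ m ∈ range p, (if m < a then b.coeff (a - 1 - m) else 0) *
      (if j ≤ m then c.coeff (m - j) else 0) =
      ∑ m ∈ Ico j a, b.coeff (a - 1 - m) * c.coeff (m - j) := by
    symm
    refine sum_subset_zero_on_sdiff (fun m hm => ?_) (fun m hm => ?_) (fun m hm => ?_)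
    · rw [mem_Ico] at hm
      rw [mem_range]
      omega
    · rw [mem_sdiff, mem_Ico] at hm
      by_cases h : m < a
      · rw [if_neg (c := j ≤ m) (by omega), mul_zero]
      · rw [if_neg h, zero_mul]
    · rw [mem_Ico] at hm
      rw [if_pos hm.1, if_pos hm.2]
  rw [h1, sum_Ico_eq_sum_range]
  split_ifs with h
  · rw [mul_comm b, PowerSeries.coeff_mul, Finset.Nat.sum_antidiagonal_eq_sum_range_succ_mk]
    have : a - j = (a - 1 - j).succ := by omega
    rw [this]
    refine sum_congr rfl fun k hk => ?_
    rw [mul_comm]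
    congr 3 <;> omega
  · rw [Nat.sub_eq_zero_of_le (by omega), sum_range_zero]

theorem toeplitz_mul_toeplitz (n : ℕ) (b c : PowerSeries ℝ) :
    toeplitz n b * toeplitz n c = toeplitz n (b * c) := by
  ext i j
  have h := sum_truncated_mul n (i + 1) j i.2 b c
  rw [← Fin.sum_univ_eq_sum_range (fun m => (if m < (i : ℕ) + 1 then b.coeff (i + 1 - 1 - m) else 0) *
      (if (j : ℕ) ≤ m then c.coeff (m - j) else 0))] at h
  simpa [Matrix.mul_apply, toeplitz, Nat.lt_succ_iff] using h

theorem toeplitz_onesSeries (n : ℕ) : toeplitz n onesSeries = allOnes n := by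
  ext i j
  simp [toeplitz, onesSeries, allOnes]

theorem sum_row_truncated (p a : ℕ) (ha : a ≤ p) (b : PowerSeries ℝ) :
    ∑ m ∈ range p, (if m < a then b.coeff (a - 1 - m) else 0) ^ 2 = l2NormSq a b := by
  have h1 : ∑ m ∈ range p, (if m < a then b.coeff (a - 1 - m) else 0) ^ 2 =
      ∑ m ∈ range a, b.coeff (a - 1 - m) ^ 2 := by
    symm
    refine sum_subset_zero_on_sdiff (range_mono ha) (fun m hm => ?_) (fun m hm => ?_)
    · rw [mem_sdiff, mem_range, mem_range] at hm
      rw [if_neg hm.2]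
      norm_num
    · rw [if_pos (by simpa using hm)]
  rw [h1, l2NormSq, sum_range_reflect (fun i => b.coeff i ^ 2) a]

theorem sum_col_truncated (p j : ℕ) (c : PowerSeries ℝ) :
    ∑ m ∈ range p, (if j ≤ m then c.coeff (m - j) else 0) ^ 2 = l2NormSq (p - j) c := by
  have h1 : ∑ m ∈ range p, (if j ≤ m then c.coeff (m - j) else 0) ^ 2 =
      ∑ m ∈ Ico j p, c.coeff (m - j) ^ 2 := by
    symm
    refine sum_subset_zero_on_sdiff (fun m hm => ?_) (fun m hm => ?_) (fun m hm => ?_)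
    · rw [mem_Ico] at hm
      rw [mem_range]
      omega
    · rw [mem_sdiff, mem_Ico, mem_range] at hm
      rw [if_neg (by omega)]
      norm_num
    · rw [mem_Ico] at hm
      rw [if_pos hm.1]
  rw [h1, sum_Ico_eq_sum_range, l2NormSq]
  simp

theorem l2NormSq_mono {m n : ℕ} (h : m ≤ n) (a : PowerSeries ℝ) : l2NormSq m a ≤ l2NormSq n a :=
  sum_le_sum_of_subset_of_nonneg (range_mono h) fun _ _ _ => sq_nonneg _

theorem toeplitz_row_sq (n : ℕ) (b : PowerSeries ℝ) (i : Fin n) :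
    ∑ j, toeplitz n b i j ^ 2 = l2NormSq (i + 1) b := by
  have h := sum_row_truncated n (i + 1) i.2 b
  rw [← Fin.sum_univ_eq_sum_range
    (fun m => (if m < (i : ℕ) + 1 then b.coeff (i + 1 - 1 - m) else 0) ^ 2)] at h
  simpa [toeplitz, Nat.lt_succ_iff] using h

theorem toeplitz_col_sq (n : ℕ) (c : PowerSeries ℝ) (j : Fin n) :
    ∑ i, toeplitz n c i j ^ 2 = l2NormSq (n - j) c := by
  have h := sum_col_truncated n j c
  rw [← Fin.sum_univ_eq_sum_range
    (fun m => (if (j : ℕ) ≤ m then c.coeff (m - j) else 0) ^ 2)] at h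
  simpa [toeplitz] using h

theorem maxRowNorm_le {a b : ℕ} (ha : 0 < a) (B : Matrix (Fin a) (Fin b) ℝ) (x : ℝ)
    (h : ∀ i, ∑ j, B i j ^ 2 ≤ x) : maxRowNorm B ≤ √x := by
  have : Nonempty (Fin a) := ⟨⟨0, ha⟩⟩
  exact ciSup_le fun i => Real.sqrt_le_sqrt (h i)

theorem maxColNorm_le {a b : ℕ} (hb : 0 < b) (C : Matrix (Fin a) (Fin b) ℝ) (x : ℝ)
    (h : ∀ j, ∑ i, C i j ^ 2 ≤ x) : maxColNorm C ≤ √x := by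
  have : Nonempty (Fin b) := ⟨⟨0, hb⟩⟩
  exact ciSup_le fun j => Real.sqrt_le_sqrt (h j)

theorem maxRowNorm_nonneg {a b : ℕ} (B : Matrix (Fin a) (Fin b) ℝ) : 0 ≤ maxRowNorm B :=
  Real.iSup_nonneg fun _ => Real.sqrt_nonneg _

theorem maxColNorm_nonneg {a b : ℕ} (C : Matrix (Fin a) (Fin b) ℝ) : 0 ≤ maxColNorm C :=
  Real.iSup_nonneg fun _ => Real.sqrt_nonneg _

theorem maxErr_le {a b c : ℕ} (ha : 0 < a) (hc : 0 < c) (B : Matrix (Fin a) (Fin b) ℝ)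
    (C : Matrix (Fin b) (Fin c) ℝ) (x y : ℝ) (hB : ∀ i, ∑ j, B i j ^ 2 ≤ x)
    (hC : ∀ j, ∑ i, C i j ^ 2 ≤ y) : maxErr B C ≤ √x * √y :=
  mul_le_mul (maxRowNorm_le ha B x hB) (maxColNorm_le hc C y hC) (maxColNorm_nonneg C)
    (Real.sqrt_nonneg x)

/-- The last row of the left factor and the first column of the right factor contain all the
coefficients. -/
theorem sq_toeplitz_le_maxErr (n : ℕ) (b c : PowerSeries ℝ) :
    √(l2NormSq (n + 1) b) * √(l2NormSq (n + 1) c)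
      ≤ maxErr (toeplitz (n + 1) b) (toeplitz (n + 1) c) := by
  refine mul_le_mul ?_ ?_ (Real.sqrt_nonneg _) (maxRowNorm_nonneg _)
  · have h := toeplitz_row_sq (n + 1) b (Fin.last n)
    rw [Fin.val_last] at h
    rw [← h]
    exact le_ciSup (f := fun i => √(∑ j, toeplitz (n + 1) b i j ^ 2))
      (Set.finite_range _).bddAbove _
  · have h := toeplitz_col_sq (n + 1) c 0
    rw [Fin.val_zero, Nat.sub_zero] at h
    rw [← h]
    exact le_ciSup (f := fun j => √(∑ i, toeplitz (n + 1) c i j ^ 2))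
      (Set.finite_range _).bddAbove _

theorem optLTToe_succ (n : ℕ) :
    optLTToe (n + 1) = ∑ i ∈ range (n + 1), invSqrtCoeff i ^ 2 := by
  refine IsLeast.csInf_eq (s := {e : ℝ | ∃ B C : Matrix (Fin (n + 1)) (Fin (n + 1)) ℝ,
    IsLTToeplitz B ∧ IsLTToeplitz C ∧ B * C = allOnes (n + 1) ∧ e = maxErr B C}) ?_
  have hlow : ∀ b c : PowerSeries ℝ, toeplitz (n + 1) b * toeplitz (n + 1) c = allOnes (n + 1) →
      ∑ i ∈ range (n + 1), invSqrtCoeff i ^ 2 ≤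
        maxErr (toeplitz (n + 1) b) (toeplitz (n + 1) c) := by
    intro b c h
    refine (landau_le n b c fun k hk => ?_).trans (sq_toeplitz_le_maxErr n b c)
    rw [toeplitz_mul_toeplitz] at h
    have h2 := congrFun (congrFun h ⟨k, hk⟩) 0
    simpa [toeplitz, allOnes] using h2
  constructor
  · have hF : toeplitz (n + 1) invSqrtSeries * toeplitz (n + 1) invSqrtSeries
        = allOnes (n + 1) := by
      rw [toeplitz_mul_toeplitz, invSqrtSeries_mul_self, toeplitz_onesSeries]
    have hT : IsLTToeplitz (toeplitz (n + 1) invSqrtSeries) :=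
      ⟨fun k => invSqrtSeries.coeff k, fun i j => rfl⟩
    refine ⟨_, _, hT, hT, hF, le_antisymm (hlow _ _ hF) ?_⟩
    have hs : ∑ i ∈ range (n + 1), invSqrtCoeff i ^ 2 = l2NormSq (n + 1) invSqrtSeries := by
      simp [l2NormSq, invSqrtSeries]
    rw [hs]
    refine (maxErr_le n.succ_pos n.succ_pos _ _ (l2NormSq (n + 1) invSqrtSeries)
      (l2NormSq (n + 1) invSqrtSeries) (fun i => ?_) fun j => ?_).trans ?_
    · rw [toeplitz_row_sq]
      exact l2NormSq_mono (by omega) _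
    · rw [toeplitz_col_sq]
      exact l2NormSq_mono (by omega) _
    · rw [Real.mul_self_sqrt (l2NormSq_nonneg _ _)]
  · rintro e ⟨B, C, ⟨b, hb⟩, ⟨c, hc⟩, hBC, rfl⟩
    have hB : B = toeplitz (n + 1) (PowerSeries.mk b) := by
      ext i j
      rw [hb]
      simp [toeplitz]
    have hC : C = toeplitz (n + 1) (PowerSeries.mk c) := by
      ext i j
      rw [hc]
      simp [toeplitz]
    subst hB hC
    exact hlow _ _ hBC

/-! ### Approximating the coefficients by impulse responses of linear filters -/

theorem integral_cos_sq_pow (i : ℕ) :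
    ∫ x in (0 : ℝ)..Real.pi / 2, (Real.cos x ^ 2) ^ i = Real.pi / 2 * invSqrtCoeff i := by
  induction i with
  | zero => simp [invSqrtCoeff_zero]
  | succ i ih =>
    simp only [← pow_mul] at ih ⊢
    rw [show 2 * (i + 1) = 2 * i + 2 by ring, integral_cos_pow, ih, invSqrtCoeff_succ]
    simp
    ring

/-- The Taylor tail of y^i at t is compared termwise with the binomial expansion of (ρ + t)^i = 1:
each term with r ≥ q carries a factor at most (3/4)^q. Expanding in units of the distance ρ from t
to 1 is what makes the bound independent of i. -/
theorem abs_taylor_pow_sub_le (y t ρ : ℝ) (ht : 0 ≤ t) (htρ : t + ρ = 1) (hρ : 0 ≤ ρ)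
    (hy : |y - t| ≤ 3 / 4 * ρ) (q i : ℕ) :
    |∑ r ∈ range q, (y - t) ^ r * (i.choose r * t ^ (i - r)) - y ^ i| ≤ (3 / 4) ^ q := by
  set g : ℕ → ℝ := fun r => (y - t) ^ r * (i.choose r * t ^ (i - r)) with hg
  set N := q + (i + 1) with hN
  have h1 : y ^ i = ∑ r ∈ range N, g r := by
    have h2 : y ^ i = ∑ r ∈ range (i + 1), g r := by
      conv_lhs => rw [← sub_add_cancel y t]
      rw [add_pow]
      refine sum_congr rfl fun r _ => ?_
      rw [hg]
      ring
    rw [h2]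
    refine sum_subset (range_mono (by omega)) fun r _ hr => ?_
    rw [hg]
    dsimp only
    rw [Nat.choose_eq_zero_of_lt (by simpa using hr)]
    simp
  have hbin : ∑ r ∈ range N, ρ ^ r * (i.choose r * t ^ (i - r)) = 1 := by
    have h2 : ∑ r ∈ range (i + 1), ρ ^ r * (i.choose r * t ^ (i - r)) = 1 := by
      have h3 : (ρ + t) ^ i = 1 := by rw [add_comm, htρ, one_pow]
      rw [← h3, add_pow]
      refine sum_congr rfl fun r _ => ?_
      ring
    rw [← h2]
    symm
    refine sum_subset (range_mono (by omega)) fun r _ hr => ?_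
    rw [Nat.choose_eq_zero_of_lt (by simpa using hr)]
    simp
  rw [h1, ← sum_range_add_sum_Ico g (show q ≤ N by omega), sub_add_cancel_left, abs_neg]
  calc |∑ r ∈ Ico q N, g r| ≤ ∑ r ∈ Ico q N, |g r| := abs_sum_le_sum_abs _ _
    _ ≤ ∑ r ∈ Ico q N, (3 / 4) ^ q * (ρ ^ r * (i.choose r * t ^ (i - r))) := by
      refine sum_le_sum fun r hr => ?_
      rw [mem_Ico] at hr
      rw [hg]
      dsimp only
      have hb : 0 ≤ (i.choose r : ℝ) * t ^ (i - r) := by positivity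
      rw [abs_mul, abs_pow, abs_of_nonneg hb, ← mul_assoc ((3 / 4 : ℝ) ^ q)]
      refine mul_le_mul_of_nonneg_right ?_ hb
      calc |y - t| ^ r ≤ (3 / 4 * ρ) ^ r := pow_le_pow_left₀ (abs_nonneg _) hy r
        _ = (3 / 4) ^ r * ρ ^ r := mul_pow _ _ _
        _ ≤ (3 / 4) ^ q * ρ ^ r := by
          refine mul_le_mul_of_nonneg_right ?_ (by positivity)
          exact pow_le_pow_of_le_one (by norm_num) (by norm_num) hr.1
    _ ≤ ∑ r ∈ range N, (3 / 4) ^ q * (ρ ^ r * (i.choose r * t ^ (i - r))) := by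
      refine sum_le_sum_of_subset_of_nonneg (fun r hr => ?_) fun r _ _ => by positivity
      rw [mem_Ico] at hr
      exact mem_range.2 hr.2
    _ = (3 / 4) ^ q := by rw [← mul_sum, hbin, mul_one]

/-- Approximation of the coefficients of `(1 - x)^(-1/2)` by sums of polynomials times powers:
Taylor expansion of the integrand of the arcsine moments on dyadic intervals. -/
theorem exists_taylor_approx (J q : ℕ) : ∃ (t : ℕ → ℝ) (w : ℕ → ℕ → ℝ), ∀ i : ℕ,
    |∑ j ∈ range J, ∑ r ∈ range q, w j r * (i.choose r * t j ^ (i - r)) - invSqrtCoeff i|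
      ≤ (1 / 2) ^ J + (3 / 4) ^ q := by
  have hpi := Real.pi_pos
  -- Halving the angle at most halves the sine, so on [x_{j+1}, x_j] the value sin² stays between
  -- ρ_j/4 and ρ_j, and cos² is within 3ρ_j/4 of t_j = cos² x_j.
  set x : ℕ → ℝ := fun j => Real.pi / 2 * (1 / 2) ^ j with hx
  have hx0 : ∀ j, 0 < x j := fun j => by positivity
  have hx1 : ∀ j, x j ≤ Real.pi / 2 := fun j =>
    mul_le_of_le_one_right (by positivity) (pow_le_one₀ (by norm_num) (by norm_num))
  have hxs : ∀ j, x (j + 1) = x j / 2 := fun j => by simp only [hx, pow_succ]; ring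
  set ρ : ℕ → ℝ := fun j => Real.sin (x j) ^ 2 with hρ
  set t : ℕ → ℝ := fun j => 1 - ρ j with ht
  -- The weights are the moments of the Taylor monomials; the minus sign compensates for the
  -- endpoints x_j decreasing. The discarded interval [0, x_J] accounts for the error 2^(-J).
  refine ⟨t, fun j r => -(2 / Real.pi * ∫ y in x j..x (j + 1), (Real.cos y ^ 2 - t j) ^ r),
    fun i => ?_⟩
  have hcont : ∀ j r, IntervalIntegrable (fun y => (Real.cos y ^ 2 - t j) ^ r)
      MeasureTheory.volume (x j) (x (j + 1)) := fun j r =>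
    (by fun_prop : Continuous fun y => (Real.cos y ^ 2 - t j) ^ r).intervalIntegrable _ _
  have hcos : Continuous fun y : ℝ => (Real.cos y ^ 2) ^ i := by fun_prop
  have h1 : ∀ j, ∑ r ∈ range q, -(2 / Real.pi * ∫ y in x j..x (j + 1), (Real.cos y ^ 2 - t j) ^ r) *
      (i.choose r * t j ^ (i - r)) = -(2 / Real.pi) * ∫ y in x j..x (j + 1),
        ∑ r ∈ range q, (Real.cos y ^ 2 - t j) ^ r * (i.choose r * t j ^ (i - r)) := by
    intro j
    rw [intervalIntegral.integral_finsetSum fun r _ => (hcont j r).mul_const _, mul_sum]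
    refine sum_congr rfl fun r _ => ?_
    rw [intervalIntegral.integral_mul_const]
    ring
  have h2 : invSqrtCoeff i = 2 / Real.pi * (∫ y in (0 : ℝ)..x J, (Real.cos y ^ 2) ^ i) -
      2 / Real.pi * ∑ j ∈ range J, ∫ y in x j..x (j + 1), (Real.cos y ^ 2) ^ i := by
    rw [intervalIntegral.sum_integral_adjacent_intervals fun j _ => hcos.intervalIntegrable _ _,
      ← mul_sub, intervalIntegral.integral_interval_sub_interval_comm' (hcos.intervalIntegrable _ _)
        (hcos.intervalIntegrable _ _) (hcos.intervalIntegrable _ _)]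
    have : x 0 = Real.pi / 2 := by simp [hx]
    rw [intervalIntegral.integral_same, this, intervalIntegral.integral_symm,
      integral_cos_sq_pow]
    field_simp
    ring
  rw [sum_congr rfl fun j _ => h1 j, ← mul_sum]
  have h3 : ∀ j, |(∫ y in x j..x (j + 1),
        ∑ r ∈ range q, (Real.cos y ^ 2 - t j) ^ r * (i.choose r * t j ^ (i - r))) -
      ∫ y in x j..x (j + 1), (Real.cos y ^ 2) ^ i| ≤ (3 / 4) ^ q * (x j - x (j + 1)) := by
    intro j
    rw [← intervalIntegral.integral_sub _ (hcos.intervalIntegrable _ _)]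
    · have hlt : x (j + 1) ≤ x j := by rw [hxs]; linarith [hx0 j]
      have hab : x j - x (j + 1) = |x (j + 1) - x j| := by
        rw [abs_sub_comm, abs_of_nonneg (by linarith)]
      rw [hab, ← Real.norm_eq_abs]
      refine intervalIntegral.norm_integral_le_of_norm_le_const fun y hy => ?_
      rw [Set.uIoc_of_ge hlt, hxs] at hy
      rw [Real.norm_eq_abs]
      have hs0 : 0 ≤ Real.sin (x j) := Real.sin_nonneg_of_nonneg_of_le_pi (hx0 j).le
        (by linarith [hx1 j])
      have hs1 : Real.sin y ≤ Real.sin (x j) :=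
        Real.sin_le_sin_of_le_of_le_pi_div_two (by linarith [hy.1, hx0 j]) (hx1 j) hy.2
      have hs2 : Real.sin (x j / 2) ≤ Real.sin y :=
        Real.sin_le_sin_of_le_of_le_pi_div_two (by linarith [hx0 j]) (by linarith [hy.2, hx1 j])
          hy.1.le
      have hs3 : Real.sin (x j) ≤ 2 * Real.sin (x j / 2) := by
        have h := Real.sin_two_mul (x j / 2)
        rw [show 2 * (x j / 2) = x j by ring] at h
        rw [h]
        have h5 : 0 ≤ Real.sin (x j / 2) := Real.sin_nonneg_of_nonneg_of_le_pi
          (by linarith [hx0 j]) (by linarith [hx1 j])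
        nlinarith [Real.cos_le_one (x j / 2)]
      refine abs_taylor_pow_sub_le _ _ (ρ j) ?_ ?_ (sq_nonneg _) ?_ _ _
      · simp only [ht, hρ]
        nlinarith [Real.sin_sq_le_one (x j)]
      · simp only [ht]
        ring
      · simp only [ht, hρ]
        rw [Real.cos_sq', abs_le]
        constructor <;> nlinarith
    · exact (by fun_prop : Continuous fun y => ∑ r ∈ range q,
        (Real.cos y ^ 2 - t j) ^ r * (i.choose r * t j ^ (i - r))).intervalIntegrable _ _
  have h4 : |∫ y in (0 : ℝ)..x J, (Real.cos y ^ 2) ^ i| ≤ x J := by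
    have := intervalIntegral.norm_integral_le_of_norm_le_const (a := 0) (b := x J) (C := 1)
      (f := fun y => (Real.cos y ^ 2) ^ i) fun y _ => by
        rw [Real.norm_eq_abs, abs_of_nonneg (by positivity)]
        exact pow_le_one₀ (sq_nonneg _) (Real.cos_sq_le_one y)
    simpa [abs_of_pos (hx0 J)] using this
  have h5 : |∑ j ∈ range J, ((∫ y in x j..x (j + 1),
        ∑ r ∈ range q, (Real.cos y ^ 2 - t j) ^ r * (i.choose r * t j ^ (i - r))) -
      ∫ y in x j..x (j + 1), (Real.cos y ^ 2) ^ i)| ≤ (3 / 4) ^ q * (Real.pi / 2) := by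
    refine (abs_sum_le_sum_abs _ _).trans ((sum_le_sum fun j _ => h3 j).trans ?_)
    rw [← mul_sum, sum_range_sub' x J]
    refine mul_le_mul_of_nonneg_left ?_ (by positivity)
    have : x 0 = Real.pi / 2 := by simp [hx]
    linarith [hx0 J]
  rw [sum_sub_distrib] at h5
  rw [h2]
  set A := ∑ j ∈ range J, ∫ y in x j..x (j + 1),
        ∑ r ∈ range q, (Real.cos y ^ 2 - t j) ^ r * (i.choose r * t j ^ (i - r))
  set B := ∑ j ∈ range J, ∫ y in x j..x (j + 1), (Real.cos y ^ 2) ^ i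
  set D := ∫ y in (0 : ℝ)..x J, (Real.cos y ^ 2) ^ i
  have h6 : -(2 / Real.pi) * A - (2 / Real.pi * D - 2 / Real.pi * B)
      = 2 / Real.pi * (-((A - B) + D)) := by ring
  rw [h6, abs_mul, abs_neg, abs_of_pos (by positivity)]
  have h7 : |A - B + D| ≤ (3 / 4) ^ q * (Real.pi / 2) + x J := (abs_add_le _ _).trans
    (add_le_add h5 h4)
  refine (mul_le_mul_of_nonneg_left h7 (by positivity)).trans (le_of_eq ?_)
  simp only [hx]
  field_simp
  ring

/-- Impulse responses of a bank of linear filters in which filter `a` is fed by filter `a - 1`. -/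
noncomputable def impulse (θ κ ι : ℕ → ℝ) : ℕ → ℕ → ℝ
  | 0, a => ι a
  | i + 1, a => θ a * impulse θ κ ι i a + κ a * impulse θ κ ι i (a - 1)

theorem sum_range_mul_eq (J q : ℕ) (g : ℕ → ℝ) :
    ∑ a ∈ range (J * q), g a = ∑ j ∈ range J, ∑ r ∈ range q, g (j * q + r) := by
  induction J with
  | zero => simp
  | succ J ih => rw [Nat.succ_mul, sum_range_add, ih, sum_range_succ]

/-- Pascal's rule: a chain of filters with common decay t, each fed by its predecessor, responds
with C(i,r) t^(i-r). The chains for the different t_j are laid end to end, and coupling 0 at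
multiples of q separates them. -/
theorem impulse_taylor (q : ℕ) (t : ℕ → ℝ) (i j r : ℕ) (hr : r < q) :
    impulse (fun a => t (a / q)) (fun a => if a % q = 0 then 0 else 1)
      (fun a => if a % q = 0 then 1 else 0) i (j * q + r) = i.choose r * t j ^ (i - r) := by
  have hdiv : ∀ r < q, (j * q + r) / q = j := fun r hr => by
    rw [mul_comm, Nat.mul_add_div (by omega), Nat.div_eq_of_lt hr, add_zero]
  have hmod : ∀ r < q, (j * q + r) % q = r := fun r hr => by
    rw [mul_comm, Nat.mul_add_mod, Nat.mod_eq_of_lt hr]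
  induction i generalizing r with
  | zero =>
    rw [impulse, hmod r hr]
    cases r <;> simp
  | succ i ih =>
    rw [impulse, hdiv r hr, hmod r hr, ih r hr]
    cases r with
    | zero => simp [pow_succ, mul_comm]
    | succ r =>
      rw [if_neg (by omega), ← add_assoc, Nat.add_sub_cancel, ih r (by omega),
        Nat.choose_succ_succ, Nat.add_sub_add_right]
      push_cast
      by_cases h : r + 1 ≤ i
      · rw [show i - r = (i - (r + 1)) + 1 by omega, pow_succ]
        ring
      · rw [Nat.choose_eq_zero_of_lt (by omega : i < r + 1)]
        simp

theorem exists_filter_bank_approx (J q : ℕ) : ∃ θ κ ι w : ℕ → ℝ, κ 0 = 0 ∧ ∀ i : ℕ,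
    |∑ a ∈ range (J * q), w a * impulse θ κ ι i a - invSqrtCoeff i|
      ≤ (1 / 2) ^ J + (3 / 4) ^ q := by
  obtain ⟨t, w, h⟩ := exists_taylor_approx J q
  refine ⟨fun a => t (a / q), fun a => if a % q = 0 then 0 else 1,
    fun a => if a % q = 0 then 1 else 0, fun a => w (a / q) (a % q), by simp, fun i => ?_⟩
  refine le_trans (le_of_eq ?_) (h i)
  rw [sum_range_mul_eq]
  congr 2
  refine sum_congr rfl fun j _ => sum_congr rfl fun r hr => ?_
  rw [mem_range] at hr
  rw [impulse_taylor q t i j r hr]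
  dsimp only
  rw [mul_comm j q, Nat.mul_add_div (by omega), Nat.div_eq_of_lt hr, add_zero, Nat.mul_add_mod,
    Nat.mod_eq_of_lt hr]

/-! ### Stability of the factorization under perturbation -/

theorem sqrt_l2NormSq_add_le (n : ℕ) (a b : PowerSeries ℝ) :
    √(l2NormSq n (a + b)) ≤ √(l2NormSq n a) + √(l2NormSq n b) := by
  have h : ∀ a : PowerSeries ℝ, √(l2NormSq n a) =
      ‖(WithLp.toLp 2 fun i : Fin n => a.coeff (i : ℕ) : EuclideanSpace ℝ (Fin n))‖ := by
    intro a
    rw [EuclideanSpace.norm_eq, l2NormSq, ← Fin.sum_univ_eq_sum_range (fun i => a.coeff i ^ 2)]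
    simp
  rw [h, h, h]
  refine le_trans (le_of_eq ?_) (norm_add_le _ _)
  congr 1

/-- Young's inequality for convolution: Cauchy-Schwarz with weights |u| bounds the k-th squared
coefficient by ‖u‖₁ times that of |u| * c², and the ℓ¹ norm is submultiplicative. -/
theorem sqrt_l2NormSq_mul_le (n : ℕ) (u c : PowerSeries ℝ) :
    √(l2NormSq n (u * c)) ≤ l1Norm n u * √(l2NormSq n c) := by
  have h1 : l2NormSq n (u * c) ≤ l1Norm n u ^ 2 * l2NormSq n c := by
    have h2 := l1Norm_mul_le n (PowerSeries.mk fun i => |u.coeff i|)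
      (PowerSeries.mk fun i => c.coeff i ^ 2)
    have h3 : l1Norm n (PowerSeries.mk fun i => |u.coeff i|) = l1Norm n u := by simp [l1Norm]
    have h4 : l1Norm n (PowerSeries.mk fun i => c.coeff i ^ 2) = l2NormSq n c := by
      simp [l1Norm, l2NormSq]
    rw [h3, h4] at h2
    calc l2NormSq n (u * c)
        ≤ ∑ k ∈ range n, l1Norm n u * |((PowerSeries.mk fun i => |u.coeff i|) *
            PowerSeries.mk fun i => c.coeff i ^ 2).coeff k| := by
          refine sum_le_sum fun k hk => ?_
          rw [mem_range] at hk
          rw [PowerSeries.coeff_mul, PowerSeries.coeff_mul]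
          simp only [PowerSeries.coeff_mk]
          rw [abs_of_nonneg (sum_nonneg fun _ _ => by positivity)]
          refine (sum_sq_le_sum_mul_sum_of_sq_le_mul (antidiagonal k)
            (f := fun p => |u.coeff p.1|) (g := fun p => |u.coeff p.1| * c.coeff p.2 ^ 2)
            (fun _ _ => abs_nonneg _) (fun _ _ => by positivity) fun p _ => le_of_eq ?_).trans ?_
          · rw [mul_pow, ← sq_abs (u.coeff p.1)]
            ring
          · refine mul_le_mul_of_nonneg_right ?_ (sum_nonneg fun _ _ => by positivity)
            rw [Finset.Nat.sum_antidiagonal_eq_sum_range_succ_mk]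
            exact sum_le_sum_of_subset_of_nonneg (range_mono (by omega)) fun _ _ _ => abs_nonneg _
      _ = l1Norm n u * l1Norm n ((PowerSeries.mk fun i => |u.coeff i|) *
            PowerSeries.mk fun i => c.coeff i ^ 2) := by
          rw [← mul_sum]
          rfl
      _ ≤ l1Norm n u * (l1Norm n u * l2NormSq n c) :=
          mul_le_mul_of_nonneg_left h2 (l1Norm_nonneg _ _)
      _ = _ := by ring
  calc √(l2NormSq n (u * c)) ≤ √(l1Norm n u ^ 2 * l2NormSq n c) := Real.sqrt_le_sqrt h1
    _ = _ := by
      rw [Real.sqrt_mul (sq_nonneg _), Real.sqrt_sq (l1Norm_nonneg _ _)]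

/-- The power series of `(1 - x)^(1/2)` has coefficients with absolute sum at most `2`. -/
theorem l1Norm_sqrtSeries_le (n : ℕ) :
    l1Norm n ((1 - PowerSeries.X) * invSqrtSeries) ≤ 2 := by
  have h1 : l1Norm (n + 1) ((1 - PowerSeries.X) * invSqrtSeries) ≤ 2 := by
    unfold l1Norm
    have h0 : ((1 - PowerSeries.X) * invSqrtSeries).coeff 0 = 1 := by
      rw [sub_mul, one_mul, map_sub, PowerSeries.coeff_zero_X_mul]
      simp [invSqrtSeries, invSqrtCoeff_zero]
    have h2 : ∀ i, |((1 - PowerSeries.X) * invSqrtSeries).coeff (i + 1)|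
        = invSqrtCoeff i - invSqrtCoeff (i + 1) := by
      intro i
      rw [sub_mul, one_mul, map_sub, PowerSeries.coeff_succ_X_mul, abs_sub_comm]
      simp only [invSqrtSeries, PowerSeries.coeff_mk]
      exact abs_of_nonneg (sub_nonneg.2 (invSqrtCoeff_succ_le i))
    rw [sum_range_succ', h0, abs_one, sum_congr rfl fun i _ => h2 i, sum_range_sub',
      invSqrtCoeff_zero]
    linarith [invSqrtCoeff_pos n]
  refine le_trans ?_ h1
  exact sum_le_sum_of_subset_of_nonneg (range_mono (by omega)) fun _ _ _ => abs_nonneg _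

/-- A small perturbation of one square root of `1 / (1 - x)` yields a small perturbation of the
complementary factor. -/
theorem exists_factor_of_approx (n : ℕ) (hn : 1 ≤ n) (b : PowerSeries ℝ) (η : ℝ)
    (hη : 2 * (n * η) ≤ 1 / 2) (hb : ∀ i, |b.coeff i - invSqrtCoeff i| ≤ η) :
    ∃ c : PowerSeries ℝ, b * c = onesSeries ∧
      √(l2NormSq n b) ≤ √(l2NormSq n invSqrtSeries) + n * η ∧
      √(l2NormSq n c) ≤ √(l2NormSq n invSqrtSeries) + √n * (4 * (n * η)) := by
  have hη0 : 0 ≤ η := (abs_nonneg _).trans (hb 0)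
  have hn' : (1 : ℝ) ≤ n := by exact_mod_cast hn
  have hb0 : PowerSeries.constantCoeff b ≠ 0 := by
    intro h
    have h1 := hb 0
    rw [PowerSeries.coeff_zero_eq_constantCoeff_apply, h, invSqrtCoeff_zero] at h1
    norm_num at h1
    nlinarith
  have hbinv : b * b⁻¹ = 1 := PowerSeries.mul_inv_cancel b hb0
  set δ : PowerSeries ℝ := b - invSqrtSeries with hδ
  have hδ1 : l1Norm n δ ≤ n * η := by
    refine (sum_le_card_nsmul _ _ η fun i _ => ?_).trans (by simp)
    rw [hδ, map_sub, invSqrtSeries, PowerSeries.coeff_mk]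
    exact hb i
  set c : PowerSeries ℝ := onesSeries * b⁻¹ with hc
  set g : PowerSeries ℝ := (1 - PowerSeries.X) * invSqrtSeries with hg
  have hbc : b * c = onesSeries := by rw [hc]; linear_combination onesSeries * hbinv
  refine ⟨c, hbc, ?_, ?_⟩
  · have h1 : b = invSqrtSeries + δ := by rw [hδ]; ring
    have h2 : √(l2NormSq n δ) ≤ n * η := by
      refine le_trans ?_ hδ1
      rw [← Real.sqrt_sq (l1Norm_nonneg n δ)]
      exact Real.sqrt_le_sqrt (sum_sq_le_l1Norm_sq _ _)
    rw [h1]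
    exact (sqrt_l2NormSq_add_le _ _ _).trans (add_le_add_right h2 _)
  -- With b = F + δ and g = (1-x)F = 1/F, the relation bc = F² reads c = F - δgc. As δg has ℓ¹ norm
  -- at most 2nη ≤ 1/2, the last term can be absorbed.
  · have hc' : c = invSqrtSeries + -(δ * g) * c := by
      rw [hδ, hg]
      linear_combination (invSqrtSeries - c) * invSqrtSeries_sq +
        ((1 - PowerSeries.X) * invSqrtSeries) * hbc -
        ((1 - PowerSeries.X) * invSqrtSeries) * invSqrtSeries_mul_self
    have hu : l1Norm n (-(δ * g)) ≤ 2 * (n * η) := by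
      have h1 : l1Norm n (-(δ * g)) = l1Norm n (δ * g) := by simp [l1Norm]
      rw [h1]
      have h2 := (l1Norm_mul_le n δ g).trans
        (mul_le_mul hδ1 (l1Norm_sqrtSeries_le n) (l1Norm_nonneg _ _) (by positivity))
      linarith
    have h1 : √(l2NormSq n c) ≤ √(l2NormSq n invSqrtSeries) + 2 * (n * η) * √(l2NormSq n c) := by
      conv_lhs => rw [hc']
      refine (sqrt_l2NormSq_add_le _ _ _).trans (add_le_add_right ?_ _)
      exact (sqrt_l2NormSq_mul_le _ _ _).trans
        (mul_le_mul_of_nonneg_right hu (Real.sqrt_nonneg _))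
    have hF : √(l2NormSq n invSqrtSeries) ≤ √n := by
      refine Real.sqrt_le_sqrt ((sum_le_card_nsmul _ _ 1 fun i _ => ?_).trans (by simp))
      rw [invSqrtSeries, PowerSeries.coeff_mk]
      exact pow_le_one₀ (invSqrtCoeff_pos i).le (invSqrtCoeff_le_one i)
    have h2 := Real.sqrt_nonneg (l2NormSq n c)
    have h4 : 0 ≤ n * η := by positivity
    -- Absorption gives the crude bound 2√n; inserting it once more into `h1` yields the sharp
    -- leading term.
    have h5 : √(l2NormSq n c) ≤ 2 * √n := by nlinarith
    have h6 := mul_le_mul_of_nonneg_left h5 (by positivity : 0 ≤ 2 * (n * η))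
    linarith

/-! ### Choosing the size of the filter bank -/

theorem filter_bank_size_le (d : ℕ) (hd : 1 ≤ d) :
    5 * (Nat.sqrt d + 1) * (12 * (Nat.sqrt d + 1)) ≤ 240 * d := by
  have h1 := Nat.sqrt_le d
  have h2 : 1 ≤ Nat.sqrt d := Nat.le_sqrt.2 (by omega)
  nlinarith

/-- The numbers 5 and 12 are chosen so that (1/2)^5 and (3/4)^12 both lie below 1/21 ≤ e^(-3). The
decay rate 3 exceeds the required π/2 by enough to pay for a factor n. -/
theorem approx_error_le (d : ℕ) :
    ((1 : ℝ) / 2) ^ (5 * (Nat.sqrt d + 1)) + (3 / 4) ^ (12 * (Nat.sqrt d + 1))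
      ≤ 2 * Real.exp (-3 * √d) := by
  have he : Real.exp 1 < 2.7182818286 := Real.exp_one_lt_d9
  have h3 : Real.exp 3 ≤ 21 := by
    rw [show (3 : ℝ) = ((3 : ℕ) : ℝ) * 1 by norm_num, Real.exp_nat_mul]
    calc Real.exp 1 ^ 3 ≤ 2.7182818286 ^ 3 := pow_le_pow_left₀ (Real.exp_pos 1).le he.le 3
      _ ≤ 21 := by norm_num
  have h3' : 1 / 21 ≤ Real.exp (-3) := by
    rw [Real.exp_neg, one_div]
    exact inv_anti₀ (Real.exp_pos 3) h3
  have hs : √(d : ℝ) ≤ ((Nat.sqrt d + 1 : ℕ) : ℝ) := by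
    rw [Real.sqrt_le_left (by positivity)]
    have := (Nat.lt_succ_sqrt' d).le
    exact_mod_cast this
  have hexp : Real.exp (-3) ^ (Nat.sqrt d + 1) ≤ Real.exp (-3 * √d) := by
    rw [← Real.exp_nat_mul]
    refine Real.exp_le_exp.2 ?_
    linarith
  have h1 : ((1 : ℝ) / 2) ^ (5 * (Nat.sqrt d + 1)) ≤ Real.exp (-3) ^ (Nat.sqrt d + 1) := by
    rw [pow_mul]
    exact pow_le_pow_left₀ (by positivity) (le_trans (by norm_num) h3') _
  have h2 : ((3 : ℝ) / 4) ^ (12 * (Nat.sqrt d + 1)) ≤ Real.exp (-3) ^ (Nat.sqrt d + 1) := by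
    rw [pow_mul]
    exact pow_le_pow_left₀ (by positivity) (le_trans (by norm_num) h3') _
  linarith

/-- A near-optimal Toeplitz factorization of the all-ones matrix whose left factor is computed by
a bank of `O(d)` linear filters. -/
theorem exists_filter_bank_factorization (n d : ℕ) (hn : 2 ≤ n)
    (hd : 2 + ((12 + 4 * Real.log (n : ℝ)) / Real.pi) ^ 2 ≤ (d : ℝ)) :
    ∃ (N : ℕ) (θ κ ι w : ℕ → ℝ) (b c : PowerSeries ℝ), N ≤ 240 * d ∧ κ 0 = 0 ∧
      (∀ i, b.coeff i = ∑ a ∈ range N, w a * impulse θ κ ι i a) ∧ b * c = onesSeries ∧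
      √(l2NormSq n b) * √(l2NormSq n c) ≤ (√(optLTToe n) +
        16 * √(n : ℝ) * Real.exp (-(Real.pi / 2) * √((d : ℝ) - 2))) ^ 2 := by
  have hpi := Real.pi_pos
  have hn1 : (1 : ℝ) ≤ n := by exact_mod_cast (by omega : 1 ≤ n)
  have hlog : 0 ≤ Real.log n := Real.log_nonneg hn1
  have hd1 : 1 ≤ d := by
    have : (2 : ℝ) ≤ d := le_trans (by nlinarith [sq_nonneg ((12 + 4 * Real.log (n : ℝ)) / Real.pi)]) hd
    have : 2 ≤ d := by exact_mod_cast this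
    omega
  set y := √((d : ℝ) - 2) with hy
  -- The hypothesis on d is used twice in this form: n ≤ exp(πy/4), and πy/2 ≥ 6, which makes E
  -- small.
  have hy1 : 12 + 4 * Real.log n ≤ Real.pi * y := by
    have h1 : (12 + 4 * Real.log (n : ℝ)) / Real.pi ≤ y :=
      Real.le_sqrt_of_sq_le (by linarith)
    rw [div_le_iff₀ hpi] at h1
    linarith
  set E := Real.exp (-(Real.pi / 2) * y) with hE
  have hE0 : 0 < E := Real.exp_pos _
  have hyd : y ≤ √d := Real.sqrt_le_sqrt (by linarith)
  have hy0 : 0 ≤ y := Real.sqrt_nonneg _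
  obtain ⟨θ, κ, ι, w, hκ, happ⟩ :=
    exists_filter_bank_approx (5 * (Nat.sqrt d + 1)) (12 * (Nat.sqrt d + 1))
  set η := ((1 : ℝ) / 2) ^ (5 * (Nat.sqrt d + 1)) + (3 / 4) ^ (12 * (Nat.sqrt d + 1)) with hη
  have hnE : (n : ℝ) * η ≤ 2 * E := by
    have h1 : (n : ℝ) ≤ Real.exp (Real.pi / 4 * y) := by
      rw [← Real.exp_log (by linarith : (0 : ℝ) < n)]
      exact Real.exp_le_exp.2 (by linarith)
    have h2 : η ≤ 2 * Real.exp (-3 * y) := (approx_error_le d).trans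
      (mul_le_mul_of_nonneg_left (Real.exp_le_exp.2 (by linarith)) (by norm_num))
    calc (n : ℝ) * η ≤ Real.exp (Real.pi / 4 * y) * (2 * Real.exp (-3 * y)) :=
          mul_le_mul h1 h2 (by positivity) (Real.exp_pos _).le
      _ = 2 * Real.exp (Real.pi / 4 * y + -3 * y) := by rw [Real.exp_add]; ring
      _ ≤ 2 * E := by
          -- The exponents compare because π/4 - 3 ≤ -π/2, that is, π ≤ 4.
          refine mul_le_mul_of_nonneg_left (Real.exp_le_exp.2 ?_) (by norm_num)
          nlinarith [Real.pi_lt_four]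
  have hE1 : E ≤ 1 / 16 := by
    have h1 : E ≤ Real.exp (-6) := Real.exp_le_exp.2 (by linarith)
    have h2 : (2 : ℝ) ^ 6 ≤ Real.exp 6 := by
      rw [show (6 : ℝ) = ((6 : ℕ) : ℝ) * 1 by norm_num, Real.exp_nat_mul]
      exact pow_le_pow_left₀ (by norm_num) (by linarith [Real.exp_one_gt_d9]) 6
    rw [Real.exp_neg] at h1
    refine h1.trans ?_
    rw [one_div]
    exact inv_anti₀ (by norm_num) (le_trans (by norm_num) h2)
  obtain ⟨c, hbc, hb2, hc2⟩ := exists_factor_of_approx n (by omega)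
    (PowerSeries.mk fun i => ∑ a ∈ range (5 * (Nat.sqrt d + 1) * (12 * (Nat.sqrt d + 1))),
      w a * impulse θ κ ι i a) η (by linarith) (fun i => by
        rw [PowerSeries.coeff_mk]
        exact happ i)
  refine ⟨_, θ, κ, ι, w, _, c, filter_bank_size_le d hd1, hκ, fun i => PowerSeries.coeff_mk _ _,
    hbc, ?_⟩
  have hopt : optLTToe n = l2NormSq n invSqrtSeries := by
    obtain ⟨k, rfl⟩ := Nat.exists_eq_add_of_le' (by omega : 1 ≤ n)
    rw [optLTToe_succ]
    simp [l2NormSq, invSqrtSeries]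
  have hsn : 1 ≤ √(n : ℝ) := Real.one_le_sqrt.2 hn1
  have hη0 : 0 ≤ η := by positivity
  have h4 : 0 ≤ n * η := by positivity
  rw [hopt, sq]
  refine mul_le_mul (hb2.trans ?_) (hc2.trans ?_) (Real.sqrt_nonneg _) (by positivity)
  · nlinarith
  · nlinarith

/-! ### A logic for running programs -/

/-- Started with registers `ρ`, the program consumes exactly `inp`, appends `out` to the output
and halts within `T` steps with registers satisfying `Q`. -/
def WP (p : Prog) (ρ : ℕ → ℝ) (inp out : List ℝ) (T : ℕ) (Q : (ℕ → ℝ) → Prop) : Prop :=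
  ∃ (ρ' : ℕ → ℝ) (t : ℕ), t ≤ T ∧ Q ρ' ∧
    ∀ rest o, Exec p ⟨ρ, inp ++ rest, o⟩ ⟨ρ', rest, o ++ out⟩ t

namespace WP

variable {p q : Prog} {ρ : ℕ → ℝ} {inp out inp' out' : List ℝ} {T T' : ℕ}
  {Q Q' : (ℕ → ℝ) → Prop}

theorem mono (h : WP p ρ inp out T Q) (hT : T ≤ T') (hQ : ∀ ρ', Q ρ' → Q' ρ') :
    WP p ρ inp out T' Q' := by
  obtain ⟨ρ', t, ht, hq, he⟩ := h
  exact ⟨ρ', t, ht.trans hT, hQ _ hq, he⟩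

theorem of_eq (hi : inp = inp') (ho : out = out') (h : WP p ρ inp out T Q) :
    WP p ρ inp' out' T Q := by
  rwa [← hi, ← ho]

theorem skip (h : Q ρ) : WP .skip ρ [] [] 1 Q :=
  ⟨ρ, 1, le_rfl, h, fun rest o => by simpa using Exec.skip ⟨ρ, rest, o⟩⟩

theorem const {r : ℕ} {x : ℝ} (h : Q (Function.update ρ r x)) : WP (.const r x) ρ [] [] 1 Q :=
  ⟨_, 1, le_rfl, h, fun rest o => by
    simpa [Config.set] using Exec.const r x ⟨ρ, rest, o⟩⟩

theorem add {r a b : ℕ} (h : Q (Function.update ρ r (ρ a + ρ b))) :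
    WP (.add r a b) ρ [] [] 1 Q :=
  ⟨_, 1, le_rfl, h, fun rest o => by
    simpa [Config.set] using Exec.add r a b ⟨ρ, rest, o⟩⟩

theorem sub {r a b : ℕ} (h : Q (Function.update ρ r (ρ a - ρ b))) :
    WP (.sub r a b) ρ [] [] 1 Q :=
  ⟨_, 1, le_rfl, h, fun rest o => by
    simpa [Config.set] using Exec.sub r a b ⟨ρ, rest, o⟩⟩

theorem mul {r a b : ℕ} (h : Q (Function.update ρ r (ρ a * ρ b))) :
    WP (.mul r a b) ρ [] [] 1 Q :=
  ⟨_, 1, le_rfl, h, fun rest o => by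
    simpa [Config.set] using Exec.mul r a b ⟨ρ, rest, o⟩⟩

theorem read {r : ℕ} {z : ℝ} (h : Q (Function.update ρ r z)) : WP (.read r) ρ [z] [] 1 Q :=
  ⟨_, 1, le_rfl, h, fun rest o => by
    simpa using Exec.read r ρ z rest o⟩

theorem write {r : ℕ} (h : Q ρ) : WP (.write r) ρ [] [ρ r] 1 Q :=
  ⟨_, 1, le_rfl, h, fun rest o => by
    simpa using Exec.write r ρ rest o⟩

/-- In `WP` the final registers and the step count are fixed before the remaining input and the
earlier output are quantified. This frame property lets the input of `q` be appended while `p` runs.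
-/
theorem seq (h : WP p ρ inp out T fun ρ' => WP q ρ' inp' out' T' Q) :
    WP (.seq p q) ρ (inp ++ inp') (out ++ out') (T + T') Q := by
  obtain ⟨ρ₁, s, hs, ⟨ρ₂, t, ht, hq, he₂⟩, he₁⟩ := h
  refine ⟨ρ₂, s + t, add_le_add hs ht, hq, fun rest o => ?_⟩
  have h1 := he₁ (inp' ++ rest) o
  have h2 := he₂ rest (o ++ out)
  rw [List.append_assoc, ← List.append_assoc o]
  exact Exec.seq h1 h2

theorem whilePos {r : ℕ} (n : ℕ) (I : ℕ → (ℕ → ℝ) → Prop) (is os : ℕ → List ℝ)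
    (h : ∀ i < n, ∀ ρ, I i ρ → 0 < ρ r ∧ WP p ρ (is i) (os i) T (I (i + 1)))
    (hend : ∀ ρ, I n ρ → ρ r ≤ 0) (h0 : I 0 ρ) :
    WP (.whilePos r p) ρ ((List.range n).flatMap is) ((List.range n).flatMap os)
      (n * (T + 1) + 1) (I n) := by
  induction n generalizing I is os ρ with
  | zero =>
    exact ⟨ρ, 1, by omega, h0, fun rest o => by
      simpa using Exec.whileStop (p := p) (c := ⟨ρ, rest, o⟩) (hend ρ h0)⟩
  | succ n ih =>
    obtain ⟨hr, ρ₁, s, hs, hI, he₁⟩ := h 0 (by omega) ρ h0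
    obtain ⟨ρ₂, t, ht, hq, he₂⟩ := ih (fun i => I (i + 1)) (fun i => is (i + 1))
      (fun i => os (i + 1)) (fun i hi ρ hρ => h (i + 1) (by omega) ρ hρ) hend hI
    refine ⟨ρ₂, s + t + 1, by nlinarith, hq, fun rest o => ?_⟩
    have h1 := he₁ ((List.range n).flatMap (fun i => is (i + 1)) ++ rest) o
    have h2 := he₂ rest (o ++ os 0)
    rw [List.range_succ_eq_map, List.flatMap_cons, List.flatMap_cons, List.flatMap_map,
      List.flatMap_map, List.append_assoc, ← List.append_assoc o]
    exact Exec.whileStep hr h1 h2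

end WP

/-- The programs `f 0, …, f (n - 1)`, one after the other. -/
def seqUp : ℕ → (ℕ → Prog) → Prog
  | 0, _ => .skip
  | n + 1, f => .seq (seqUp n f) (f n)

theorem WP.seqUp {ρ : ℕ → ℝ} {T : ℕ} {f : ℕ → Prog} (n : ℕ) (I : ℕ → (ℕ → ℝ) → Prop)
    (is os : ℕ → List ℝ)
    (h : ∀ i < n, ∀ ρ, I i ρ → WP (f i) ρ (is i) (os i) T (I (i + 1))) (h0 : I 0 ρ) :
    WP (seqUp n f) ρ ((List.range n).flatMap is) ((List.range n).flatMap os) (n * T + 1) (I n) := by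
  induction n with
  | zero => simpa [ContinualCounting.seqUp] using WP.skip h0
  | succ n ih =>
    rw [List.range_succ, List.flatMap_append, List.flatMap_append]
    have h1 := ih fun i hi => h i (by omega)
    have h2 := WP.seq (h1.mono le_rfl fun ρ' hρ' => h n (by omega) ρ' hρ')
    simp only [List.flatMap_singleton]
    exact h2.mono (by nlinarith) fun _ h => h

theorem flatMap_const_nil (l : List ℕ) : l.flatMap (fun _ => ([] : List ℝ)) = [] := by
  induction l with
  | nil => rfl
  | cons a l ih => simp [List.flatMap_cons, ih]

theorem flatMap_singleton_eq_map (l : List ℕ) (f : ℕ → ℝ) :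
    l.flatMap (fun c => [f c]) = l.map f := by
  induction l with
  | nil => rfl
  | cons a l ih => simp [List.flatMap_cons, ih]

theorem WP.seqUp_silent {ρ : ℕ → ℝ} {T : ℕ} {f : ℕ → Prog} (n : ℕ) (I : ℕ → (ℕ → ℝ) → Prop)
    (h : ∀ i < n, ∀ ρ, I i ρ → WP (f i) ρ [] [] T (I (i + 1))) (h0 : I 0 ρ) :
    WP (ContinualCounting.seqUp n f) ρ [] [] (n * T + 1) (I n) := by
  have h1 := WP.seqUp n I (fun _ => []) (fun _ => []) h h0
  rwa [flatMap_const_nil] at h1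

theorem length_seqUp_le (n : ℕ) (f : ℕ → Prog) (L : ℕ) (h : ∀ i, (f i).length ≤ L) :
    (seqUp n f).length ≤ n * (L + 1) + 1 := by
  induction n with
  | zero => simp [seqUp, Prog.length]
  | succ n ih =>
    simp only [seqUp, Prog.length]
    have := h n
    nlinarith

theorem card_registers_le (p : Prog) : p.registers.card ≤ 3 * p.length := by
  induction p with
  | skip => simp [Prog.registers]
  | const r x => simp [Prog.registers, Prog.length]
  | add r a b => exact card_le_three
  | sub r a b => exact card_le_three
  | mul r a b => exact card_le_three
  | read r => simp [Prog.registers, Prog.length]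
  | write r => simp [Prog.registers, Prog.length]
  | seq p q hp hq =>
    have := card_union_le p.registers q.registers
    simp only [Prog.registers, Prog.length]
    omega
  | whilePos r p hp =>
    have := card_insert_le r p.registers
    simp only [Prog.registers, Prog.length]
    omega

/-! ### Programs for one bank of filters -/

/-- The register of the given level, kind, column and position. -/
def reg (l k c a : ℕ) : ℕ := Nat.pair l (Nat.pair k (Nat.pair c a))

theorem reg_inj (l k c a l' k' c' a' : ℕ) :
    reg l k c a = reg l' k' c' a' ↔ l = l' ∧ k = k' ∧ c = c' ∧ a = a' := by
  simp [reg, Nat.pair_eq_pair]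

/-- The level of a register. -/
def regLevel (x : ℕ) : ℕ := x.unpair.1

theorem regLevel_reg (l k c a : ℕ) : regLevel (reg l k c a) = l := by
  simp [regLevel, reg]

/-- Scratch register. -/
abbrev rTmp : ℕ := reg 0 0 0 0
/-- Input register. -/
abbrev rIn : ℕ := reg 0 1 0 0
/-- Loop counter of a level. -/
abbrev rCtr (l : ℕ) : ℕ := reg l 2 0 0
/-- State of filter `a` for column `c`. -/
abbrev rBuf (l c a : ℕ) : ℕ := reg l 3 c a
/-- Partial output for column `c`. -/
abbrev rVal (l c : ℕ) : ℕ := reg l 4 c 0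

/-- A bank of linear filters with output weights. -/
structure FilterBank where
  /-- number of filters -/
  size : ℕ
  /-- decay factors -/
  decay : ℕ → ℝ
  /-- couplings to the preceding filter -/
  coupling : ℕ → ℝ
  /-- input weights -/
  gain : ℕ → ℝ
  /-- output weights -/
  weight : ℕ → ℝ
  coupling_zero : coupling 0 = 0

namespace FilterBank

variable (F : FilterBank)

/-- One step of a single filter. -/
def updateFilter (l c a : ℕ) : Prog :=
  .seq (.const rTmp (F.decay a)) <| .seq (.mul (rBuf l c a) (rBuf l c a) rTmp) <|
  .seq (.const rTmp (F.coupling a)) <| .seq (.mul rTmp rTmp (rBuf l c (a - 1))) <|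
  .seq (.add (rBuf l c a) (rBuf l c a) rTmp) <| .seq (.const rTmp (F.gain a)) <|
  .seq (.mul rTmp rTmp rIn) <| .add (rBuf l c a) (rBuf l c a) rTmp

/-- For a = 0 the truncated index a - 1 is a itself, a register already overwritten at that point;
`coupling_zero` removes this term. -/
theorem wp_updateFilter (l c a : ℕ) (ρ : ℕ → ℝ) :
    WP (F.updateFilter l c a) ρ [] [] 8 fun ρ' =>
      ρ' (rBuf l c a) = F.decay a * ρ (rBuf l c a) + F.coupling a * ρ (rBuf l c (a - 1)) +
        F.gain a * ρ rIn ∧ ∀ x, x ≠ rTmp → x ≠ rBuf l c a → ρ' x = ρ x := by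
  refine WP.seq (inp := []) (out := []) (T := 1) <| WP.const <|
    WP.seq (inp := []) (out := []) (T := 1) <| WP.mul <|
    WP.seq (inp := []) (out := []) (T := 1) <| WP.const <|
    WP.seq (inp := []) (out := []) (T := 1) <| WP.mul <|
    WP.seq (inp := []) (out := []) (T := 1) <| WP.add <|
    WP.seq (inp := []) (out := []) (T := 1) <| WP.const <|
    WP.seq (inp := []) (out := []) (T := 1) <| WP.mul <| WP.add ⟨?_, fun x hx hx' => ?_⟩
  · rcases Nat.eq_zero_or_pos a with rfl | ha
    · simp [reg_inj, F.coupling_zero]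
      ring
    · have : a - 1 ≠ a := by omega
      simp [reg_inj, this]
      ring
  · simp [Function.update_apply, hx, hx']

/-- One step of all filters of a column, last filter first. -/
def updateColumn (l c : ℕ) : Prog := seqUp F.size fun k => F.updateFilter l c (F.size - 1 - k)

/-- Filter a needs the old state of filter a - 1, so the filters are updated in descending order.
The invariant says that after k steps exactly the top k filters are new. -/
theorem wp_updateColumn (l c : ℕ) (ρ : ℕ → ℝ) :
    WP (F.updateColumn l c) ρ [] [] (F.size * 8 + 1) fun ρ' =>
      (∀ a < F.size, ρ' (rBuf l c a) = F.decay a * ρ (rBuf l c a) +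
        F.coupling a * ρ (rBuf l c (a - 1)) + F.gain a * ρ rIn) ∧
      ∀ x, x ≠ rTmp → (∀ a, x ≠ rBuf l c a) → ρ' x = ρ x := by
  refine (WP.seqUp_silent F.size (fun k ρ' =>
    (∀ a < F.size, F.size ≤ a + k → ρ' (rBuf l c a) = F.decay a * ρ (rBuf l c a) +
        F.coupling a * ρ (rBuf l c (a - 1)) + F.gain a * ρ rIn) ∧
    ∀ x, x ≠ rTmp → (∀ a < F.size, F.size ≤ a + k → x ≠ rBuf l c a) → ρ' x = ρ x)
      (fun k hk ρ₁ h => ?_) ?_).mono le_rfl ?_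
  · obtain ⟨h1, h2⟩ := h
    refine (F.wp_updateFilter l c (F.size - 1 - k) ρ₁).mono le_rfl fun ρ₂ h => ?_
    obtain ⟨h3, h4⟩ := h
    have hold : ∀ a, a + k < F.size → ρ₁ (rBuf l c a) = ρ (rBuf l c a) := by
      intro a ha
      refine h2 _ (by simp [reg_inj]) fun a' _ ha' h => ?_
      simp only [reg_inj, true_and] at h
      omega
    refine ⟨fun a ha hak => ?_, fun x hx hx' => ?_⟩
    · by_cases hlast : a = F.size - 1 - k
      · rw [hlast, h3, hold _ (by omega), hold _ (by omega), h2 rIn (by simp [reg_inj])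
          fun a _ _ => by simp [reg_inj]]
      · rw [h4 _ (by simp [reg_inj]) (by simpa [reg_inj] using hlast), h1 a ha (by omega)]
    · rw [h4 x hx (hx' _ (by omega) (by omega)), h2 x hx fun a ha hak => hx' a ha (by omega)]
  · exact ⟨fun a ha hak => absurd hak (by omega), fun _ _ _ => rfl⟩
  · rintro ρ' ⟨h1, h2⟩
    exact ⟨fun a ha => h1 a ha (by omega), fun x hx hx' => h2 x hx fun a _ _ => hx' a⟩

/-- Read one row of `m` numbers and feed it to the filters. -/
def readRow (m l : ℕ) : Prog := seqUp m fun c => .seq (.read rIn) (F.updateColumn l c)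

theorem wp_readRow (m l : ℕ) (ρ : ℕ → ℝ) (z : ℕ → ℝ) :
    WP (F.readRow m l) ρ ((List.range m).map z) [] (m * (F.size * 8 + 2) + 1) fun ρ' =>
      (∀ c < m, ∀ a < F.size, ρ' (rBuf l c a) = F.decay a * ρ (rBuf l c a) +
        F.coupling a * ρ (rBuf l c (a - 1)) + F.gain a * z c) ∧
      ∀ x, x ≠ rTmp → x ≠ rIn → (∀ c a, x ≠ rBuf l c a) → ρ' x = ρ x := by
  have key := WP.seqUp (ρ := ρ) (T := F.size * 8 + 2)
    (f := fun c => .seq (.read rIn) (F.updateColumn l c)) m (fun k ρ' =>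
    (∀ c < k, ∀ a < F.size, ρ' (rBuf l c a) = F.decay a * ρ (rBuf l c a) +
        F.coupling a * ρ (rBuf l c (a - 1)) + F.gain a * z c) ∧
    ∀ x, x ≠ rTmp → x ≠ rIn → (∀ c < k, ∀ a, x ≠ rBuf l c a) → ρ' x = ρ x)
    (fun c => [z c]) (fun _ => []) (fun k hk ρ₁ h => ?_) ?_
  · rw [flatMap_singleton_eq_map, flatMap_const_nil] at key
    refine key.mono le_rfl ?_
    rintro ρ' ⟨h1, h2⟩
    exact ⟨h1, fun x hx hx' hx'' => h2 x hx hx' fun c _ => hx'' c⟩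
  · obtain ⟨h1, h2⟩ := h
    refine (WP.seq (inp := [z k]) (inp' := []) (out := []) (out' := []) (T := 1)
      (WP.read (F.wp_updateColumn l k _))).mono (by omega) fun ρ₂ h => ?_
    obtain ⟨h3, h4⟩ := h
    have hold : ∀ a, ρ₁ (rBuf l k a) = ρ (rBuf l k a) := by
      intro a
      refine h2 _ (by simp [reg_inj]) (by simp [reg_inj]) fun c hc a' h => ?_
      simp only [reg_inj, true_and] at h
      omega
    refine ⟨fun c hc a ha => ?_, fun x hx hx' hx'' => ?_⟩
    · by_cases hck : c = k
      · subst hck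
        rw [h3 a ha]
        simp [reg_inj, hold]
      · rw [h4 _ (by simp [reg_inj]) fun a' => by simp [reg_inj, hck],
          Function.update_of_ne (by simp [reg_inj]), h1 c (by omega) a ha]
    · rw [h4 x hx (hx'' k (by omega)), Function.update_of_ne hx',
        h2 x hx hx' fun c hc => hx'' c (by omega)]
  · exact ⟨fun c hc => absurd hc (by omega), fun _ _ _ _ => rfl⟩

/-- Add the filter output for column `c` to the partial output of the enclosing level. -/
def computeVal (l c : ℕ) : Prog :=
  .seq (.const rTmp 0) <| .seq (.add (rVal l c) (rVal (l + 1) c) rTmp) <|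
  seqUp F.size fun a => .seq (.const rTmp (F.weight a)) <|
    .seq (.mul rTmp rTmp (rBuf l c a)) (.add (rVal l c) (rVal l c) rTmp)

/-- Adding 0 serves as the copy instruction for the value of level l + 1. At the top level that
register is never written and still holds its initial 0. -/
theorem wp_computeVal (l c : ℕ) (ρ : ℕ → ℝ) :
    WP (F.computeVal l c) ρ [] [] (F.size * 3 + 3) fun ρ' =>
      ρ' (rVal l c) = ρ (rVal (l + 1) c) + ∑ a ∈ range F.size, F.weight a * ρ (rBuf l c a) ∧
      ∀ x, x ≠ rTmp → x ≠ rVal l c → ρ' x = ρ x := by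
  refine (WP.seq (inp := []) (out := []) (T := 1) <| WP.const <|
    WP.seq (inp := []) (out := []) (inp' := []) (out' := []) (T := 1) <| WP.add <|
    WP.seqUp_silent (T := 3) F.size (fun k ρ' =>
      ρ' (rVal l c) = ρ (rVal (l + 1) c) + ∑ a ∈ range k, F.weight a * ρ (rBuf l c a) ∧
      ∀ x, x ≠ rTmp → x ≠ rVal l c → ρ' x = ρ x) (fun k hk ρ₁ h => ?_) ?_).mono (by omega)
      fun _ h => h
  · obtain ⟨h1, h2⟩ := h
    refine WP.seq (inp := []) (out := []) (T := 1) <| WP.const <|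
      WP.seq (inp := []) (out := []) (T := 1) <| WP.mul <| WP.add ⟨?_, fun x hx hx' => ?_⟩
    · rw [sum_range_succ, ← add_assoc, ← h1, ← h2 (rBuf l c k) (by simp [reg_inj])
        (by simp [reg_inj])]
      simp [reg_inj]
    · simp [Function.update_apply, hx, hx', h2 x hx hx']
  · refine ⟨?_, fun x hx hx' => ?_⟩
    · simp [reg_inj]
    · simp [Function.update_apply, hx, hx']

/-- Compute the partial outputs for all columns. -/
def computeVals (m l : ℕ) : Prog := seqUp m (F.computeVal l)

theorem wp_computeVals (m l : ℕ) (ρ : ℕ → ℝ) :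
    WP (F.computeVals m l) ρ [] [] (m * (F.size * 3 + 3) + 1) fun ρ' =>
      (∀ c < m, ρ' (rVal l c) = ρ (rVal (l + 1) c) +
        ∑ a ∈ range F.size, F.weight a * ρ (rBuf l c a)) ∧
      ∀ x, x ≠ rTmp → (∀ c, x ≠ rVal l c) → ρ' x = ρ x := by
  refine (WP.seqUp_silent m (fun k ρ' =>
    (∀ c < k, ρ' (rVal l c) = ρ (rVal (l + 1) c) +
        ∑ a ∈ range F.size, F.weight a * ρ (rBuf l c a)) ∧
      ∀ x, x ≠ rTmp → (∀ c, x ≠ rVal l c) → ρ' x = ρ x) (fun k hk ρ₁ h => ?_) ?_).mono le_rfl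
        fun _ h => h
  · obtain ⟨h1, h2⟩ := h
    refine (F.wp_computeVal l k ρ₁).mono le_rfl fun ρ₂ h => ?_
    obtain ⟨h3, h4⟩ := h
    refine ⟨fun c hc => ?_, fun x hx hx' => ?_⟩
    · by_cases hck : c = k
      · subst hck
        rw [h3, h2 _ (by simp [reg_inj]) (by simp [reg_inj])]
        congr 1
        refine sum_congr rfl fun a _ => ?_
        rw [h2 _ (by simp [reg_inj]) (by simp [reg_inj])]
      · rw [h4 _ (by simp [reg_inj]) (by simpa [reg_inj] using hck), h1 c (by omega)]
    · rw [h4 x hx (hx' k), h2 x hx hx']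
  · exact ⟨fun c hc => absurd hc (by omega), fun _ _ _ => rfl⟩

/-- Set the filters of all columns to `0`. -/
def reset (m l : ℕ) : Prog := seqUp m fun c => seqUp F.size fun a => .const (rBuf l c a) 0

theorem wp_reset (m l : ℕ) (ρ : ℕ → ℝ) :
    WP (F.reset m l) ρ [] [] (m * (F.size * 1 + 1) + 1) fun ρ' =>
      (∀ c < m, ∀ a < F.size, ρ' (rBuf l c a) = 0) ∧
      ∀ x, (∀ c a, x ≠ rBuf l c a) → ρ' x = ρ x := by
  refine WP.seqUp_silent m (fun k ρ' => (∀ c < k, ∀ a < F.size, ρ' (rBuf l c a) = 0) ∧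
      ∀ x, (∀ c a, x ≠ rBuf l c a) → ρ' x = ρ x) (fun k hk ρ₁ h => ?_) ?_
  · refine (WP.seqUp_silent F.size (fun j ρ' => (∀ c < k, ∀ a < F.size, ρ' (rBuf l c a) = 0) ∧
      (∀ a < j, ρ' (rBuf l k a) = 0) ∧
      ∀ x, (∀ c a, x ≠ rBuf l c a) → ρ' x = ρ x) (fun j hj ρ₂ h => ?_) ?_).mono le_rfl ?_
    · obtain ⟨h1, h2, h3⟩ := h
      refine WP.const ⟨fun c hc a ha => ?_, fun a ha => ?_, fun x hx => ?_⟩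
      · rw [Function.update_apply, h1 c hc a ha]
        simp
      · rw [Function.update_apply]
        split_ifs with h
        · rfl
        · refine h2 a ?_
          simp only [reg_inj, true_and] at h
          omega
      · rw [Function.update_of_ne (hx _ _), h3 x hx]
    · exact ⟨h.1, fun a ha => absurd ha (by omega), h.2⟩
    · rintro ρ' ⟨h1, h2, h3⟩
      refine ⟨fun c hc a ha => ?_, h3⟩
      rcases Nat.lt_succ_iff_lt_or_eq.1 hc with hc | rfl
      exacts [h1 c hc a ha, h2 a ha]
  · exact ⟨fun c hc => absurd hc (by omega), fun _ _ => rfl⟩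

end FilterBank

/-- Write the partial outputs of all columns. -/
def writeVals (m l : ℕ) : Prog := seqUp m fun c => .write (rVal l c)

theorem wp_writeVals (m l : ℕ) (ρ : ℕ → ℝ) :
    WP (writeVals m l) ρ [] ((List.range m).map fun c => ρ (rVal l c)) (m * 1 + 1)
      fun ρ' => ρ' = ρ := by
  have key := WP.seqUp (ρ := ρ) (T := 1) (f := fun c => .write (rVal l c)) m (fun _ ρ' => ρ' = ρ)
    (fun _ => []) (fun c => [ρ (rVal l c)]) (fun k hk ρ₁ h => by
      subst h
      exact WP.write rfl) rfl
  rwa [flatMap_const_nil, flatMap_singleton_eq_map] at key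

/-- Decrement the loop counter. -/
def decrement (l : ℕ) : Prog := .seq (.const rTmp 1) (.sub (rCtr l) (rCtr l) rTmp)

theorem wp_decrement (l : ℕ) (ρ : ℕ → ℝ) :
    WP (decrement l) ρ [] [] 2 fun ρ' => ρ' (rCtr l) = ρ (rCtr l) - 1 ∧
      ∀ x, x ≠ rTmp → x ≠ rCtr l → ρ' x = ρ x := by
  refine WP.seq (inp := []) (out := []) (T := 1) <| WP.const <| WP.sub ⟨?_, fun x hx hx' => ?_⟩
  · simp [reg_inj]
  · simp [Function.update_apply, hx, hx']

/-! ### The recursive factorization -/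

/-- The number of rows of the left factor at a given recursion level. -/
def levelRows (p : ℕ) : ℕ → ℕ
  | 0 => p
  | l + 1 => p * levelRows p l

/-- The number of columns of the left factor at a given recursion level. -/
def levelCols (p : ℕ) : ℕ → ℕ
  | 0 => p
  | l + 1 => p * (levelCols p l + 1)

/-- The entries of the left factor. A level consists of `p` blocks, each of them a copy of the
preceding level followed by one column for the block as a whole. -/
noncomputable def leftFactor (b : PowerSeries ℝ) (p : ℕ) : ℕ → ℕ → ℕ → ℝ
  | 0, i, j => if j < i + 1 then b.coeff (i + 1 - 1 - j) else 0
  | l + 1, i, j =>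
    if j % (levelCols p l + 1) = levelCols p l then
      if j / (levelCols p l + 1) < i / levelRows p l then
        b.coeff (i / levelRows p l - 1 - j / (levelCols p l + 1)) else 0
    else if j / (levelCols p l + 1) = i / levelRows p l then
      leftFactor b p l (i % levelRows p l) (j % (levelCols p l + 1)) else 0

/-- The entries of the right factor. -/
noncomputable def rightFactor (c : PowerSeries ℝ) (p : ℕ) : ℕ → ℕ → ℕ → ℝ
  | 0, j, i => if i ≤ j then c.coeff (j - i) else 0
  | l + 1, j, i =>
    if j % (levelCols p l + 1) = levelCols p l then
      if i / levelRows p l ≤ j / (levelCols p l + 1) then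
        c.coeff (j / (levelCols p l + 1) - i / levelRows p l) else 0
    else if j / (levelCols p l + 1) = i / levelRows p l then
      rightFactor c p l (j % (levelCols p l + 1)) (i % levelRows p l) else 0

section Blocks

variable {k j r : ℕ}

theorem block_div (h : r < k) : (j * k + r) / k = j := by
  rw [mul_comm, Nat.mul_add_div (by omega), Nat.div_eq_of_lt h, add_zero]

theorem block_mod (h : r < k) : (j * k + r) % k = r := by
  rw [mul_comm, Nat.mul_add_mod, Nat.mod_eq_of_lt h]

end Blocks

theorem leftFactor_succ_inner (b : PowerSeries ℝ) (p l i j r : ℕ) (h : r < levelCols p l) :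
    leftFactor b p (l + 1) i (j * (levelCols p l + 1) + r) =
      if j = i / levelRows p l then leftFactor b p l (i % levelRows p l) r else 0 := by
  rw [leftFactor, block_div (by omega), block_mod (by omega), if_neg h.ne]

theorem leftFactor_succ_last (b : PowerSeries ℝ) (p l i j : ℕ) :
    leftFactor b p (l + 1) i (j * (levelCols p l + 1) + levelCols p l) =
      if j < i / levelRows p l then b.coeff (i / levelRows p l - 1 - j) else 0 := by
  rw [leftFactor, block_div (by omega), block_mod (by omega), if_pos rfl]

theorem rightFactor_succ_inner (c : PowerSeries ℝ) (p l i j r : ℕ) (h : r < levelCols p l) :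
    rightFactor c p (l + 1) (j * (levelCols p l + 1) + r) i =
      if j = i / levelRows p l then rightFactor c p l r (i % levelRows p l) else 0 := by
  rw [rightFactor, block_div (by omega), block_mod (by omega), if_neg h.ne]

theorem rightFactor_succ_last (c : PowerSeries ℝ) (p l i j : ℕ) :
    rightFactor c p (l + 1) (j * (levelCols p l + 1) + levelCols p l) i =
      if i / levelRows p l ≤ j then c.coeff (j - i / levelRows p l) else 0 := by
  rw [rightFactor, block_div (by omega), block_mod (by omega), if_pos rfl]

theorem sum_levelCols_succ (p l : ℕ) (g : ℕ → ℝ) :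
    ∑ j ∈ range (levelCols p (l + 1)), g j =
      ∑ j ∈ range p, ∑ r ∈ range (levelCols p l), g (j * (levelCols p l + 1) + r) +
      ∑ j ∈ range p, g (j * (levelCols p l + 1) + levelCols p l) := by
  rw [levelCols, sum_range_mul_eq, ← sum_add_distrib]
  exact sum_congr rfl fun j _ => sum_range_succ _ _

theorem levelRows_pos {p : ℕ} (hp : 0 < p) (l : ℕ) : 0 < levelRows p l := by
  induction l with
  | zero => exact hp
  | succ l ih => exact Nat.mul_pos hp ih

theorem div_levelRows_lt {p l i : ℕ} (hi : i < levelRows p (l + 1)) : i / levelRows p l < p :=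
  Nat.div_lt_of_lt_mul (by rwa [levelRows, mul_comm] at hi)

/-- Compare the blocks of i and i'. The block columns contribute 1 exactly when the block of i' lies
strictly before that of i; the inner columns contribute only when the blocks coincide, and then the
induction hypothesis applies to the remainders. -/
theorem sum_leftFactor_mul_rightFactor {b c : PowerSeries ℝ} (hbc : b * c = onesSeries) {p : ℕ}
    (hp : 0 < p) (l i i' : ℕ) (hi : i < levelRows p l) (hi' : i' < levelRows p l) :
    ∑ j ∈ range (levelCols p l), leftFactor b p l i j * rightFactor c p l j i' =
      if i' ≤ i then 1 else 0 := by
  have hone : ∀ k, onesSeries.coeff k = 1 := fun k => by simp [onesSeries]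
  induction l generalizing i i' with
  | zero =>
    simp only [leftFactor, rightFactor, levelCols]
    rw [sum_truncated_mul p (i + 1) i' hi, hbc, hone]
    simp only [Nat.lt_succ_iff]
  | succ l ih =>
    have hq := levelRows_pos hp l
    rw [sum_levelCols_succ]
    simp only [leftFactor_succ_last, rightFactor_succ_last]
    rw [sum_truncated_mul p _ _ (div_levelRows_lt hi).le, hbc, hone]
    have h1 : ∑ j ∈ range p, ∑ r ∈ range (levelCols p l),
        leftFactor b p (l + 1) i (j * (levelCols p l + 1) + r) *
          rightFactor c p (l + 1) (j * (levelCols p l + 1) + r) i' =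
        if i / levelRows p l = i' / levelRows p l then
          if i' % levelRows p l ≤ i % levelRows p l then 1 else 0 else 0 := by
      rw [sum_eq_single (i / levelRows p l)]
      · rw [sum_congr rfl fun r hr => by
          rw [leftFactor_succ_inner _ _ _ _ _ _ (mem_range.1 hr),
            rightFactor_succ_inner _ _ _ _ _ _ (mem_range.1 hr), if_pos rfl]]
        split_ifs with h2 h3
        · rw [ih _ _ (Nat.mod_lt _ hq) (Nat.mod_lt _ hq), if_pos h3]
        · rw [ih _ _ (Nat.mod_lt _ hq) (Nat.mod_lt _ hq), if_neg h3]
        · simp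
      · intro j _ hj
        refine sum_eq_zero fun r hr => ?_
        rw [leftFactor_succ_inner _ _ _ _ _ _ (mem_range.1 hr), if_neg hj, zero_mul]
      · intro h
        exact absurd (mem_range.2 (div_levelRows_lt hi)) h
    rw [h1]
    have h2 := Nat.div_add_mod i (levelRows p l)
    have h3 := Nat.div_add_mod i' (levelRows p l)
    have h4 := Nat.mod_lt i hq
    have h5 := Nat.mod_lt i' hq
    rcases lt_trichotomy (i' / levelRows p l) (i / levelRows p l) with h | h | h
    · rw [if_neg h.ne', if_pos h, if_pos (Nat.lt_of_div_lt_div h).le, zero_add]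
    · rw [h] at h3 ⊢
      rw [if_pos rfl, if_neg (lt_irrefl _), add_zero]
      congr 1
      rw [eq_iff_iff]
      omega
    · rw [if_neg h.ne, if_neg h.not_gt, if_neg fun hle => h.not_ge (Nat.div_le_div_right hle),
        zero_add]

/-- A row meets the inner columns of just one block, where it is a row of the preceding level, and
otherwise only the block columns, whose energy is at most that of b. So each level adds one copy. -/
theorem leftFactor_row_sq_le (b : PowerSeries ℝ) {p : ℕ} (hp : 0 < p) (l i : ℕ)
    (hi : i < levelRows p l) :
    ∑ j ∈ range (levelCols p l), leftFactor b p l i j ^ 2 ≤ (l + 1 : ℕ) * l2NormSq p b := by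
  induction l generalizing i with
  | zero =>
    simp only [leftFactor, levelCols]
    rw [sum_row_truncated p (i + 1) hi]
    simpa using l2NormSq_mono (show i + 1 ≤ p from hi) b
  | succ l ih =>
    rw [sum_levelCols_succ]
    simp only [leftFactor_succ_last]
    rw [sum_row_truncated p _ (div_levelRows_lt hi).le, sum_eq_single (i / levelRows p l)]
    · rw [sum_congr rfl fun r hr => by
          rw [leftFactor_succ_inner _ _ _ _ _ _ (mem_range.1 hr), if_pos rfl]]
      have h1 := ih _ (Nat.mod_lt i (levelRows_pos hp l))
      have h2 := l2NormSq_mono (div_levelRows_lt hi).le b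
      push_cast at h1 ⊢
      linarith
    · intro j _ hj
      refine sum_eq_zero fun r hr => ?_
      rw [leftFactor_succ_inner _ _ _ _ _ _ (mem_range.1 hr), if_neg hj]
      norm_num
    · intro h
      exact absurd (mem_range.2 (div_levelRows_lt hi)) h

theorem rightFactor_col_sq_le (c : PowerSeries ℝ) {p : ℕ} (hp : 0 < p) (l i : ℕ)
    (hi : i < levelRows p l) :
    ∑ j ∈ range (levelCols p l), rightFactor c p l j i ^ 2 ≤ (l + 1 : ℕ) * l2NormSq p c := by
  induction l generalizing i with
  | zero =>
    simp only [rightFactor, levelCols]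
    rw [sum_col_truncated]
    simpa using l2NormSq_mono (Nat.sub_le p i) c
  | succ l ih =>
    rw [sum_levelCols_succ]
    simp only [rightFactor_succ_last]
    rw [sum_col_truncated, sum_eq_single (i / levelRows p l)]
    · rw [sum_congr rfl fun r hr => by
          rw [rightFactor_succ_inner _ _ _ _ _ _ (mem_range.1 hr), if_pos rfl]]
      have h1 := ih _ (Nat.mod_lt i (levelRows_pos hp l))
      have h2 := l2NormSq_mono (Nat.sub_le p (i / levelRows p l)) c
      push_cast at h1 ⊢
      linarith
    · intro j _ hj
      refine sum_eq_zero fun r hr => ?_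
      rw [rightFactor_succ_inner _ _ _ _ _ _ (mem_range.1 hr), if_neg hj]
      norm_num
    · intro h
      exact absurd (mem_range.2 (div_levelRows_lt hi)) h

/-! ### The recursive streaming program, its correctness and its cost -/

/-- The stream of the first `m` entries of the first `a` rows of an array. -/
def arrayStream (a m : ℕ) (Z : ℕ → ℕ → ℝ) : List ℝ :=
  (List.range a).flatMap fun i => (List.range m).map (Z i)

theorem arrayStream_congr {a m : ℕ} {Z Z' : ℕ → ℕ → ℝ} (h : ∀ i < a, ∀ c < m, Z i c = Z' i c) :
    arrayStream a m Z = arrayStream a m Z' := by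
  refine List.flatMap_congr fun i hi => List.map_congr_left fun c hc => ?_
  exact h i (List.mem_range.1 hi) c (List.mem_range.1 hc)

theorem arrayStream_add (a a' m : ℕ) (Z : ℕ → ℕ → ℝ) :
    arrayStream (a + a') m Z = arrayStream a m Z ++ arrayStream a' m fun i => Z (a + i) := by
  simp [arrayStream, List.range_add, List.flatMap_append, List.flatMap_map]

theorem arrayStream_mul (a q m : ℕ) (Z : ℕ → ℕ → ℝ) :
    arrayStream (a * q) m Z = (List.range a).flatMap fun i =>
      arrayStream q m fun i' => Z (i * q + i') := by
  induction a with
  | zero => simp [arrayStream]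
  | succ a ih =>
    rw [Nat.succ_mul, arrayStream_add, ih, List.range_succ, List.flatMap_append,
      List.flatMap_singleton]

theorem arrayStream_succ (a m : ℕ) (Z : ℕ → ℕ → ℝ) :
    arrayStream (a + 1) m Z = arrayStream a m Z ++ (List.range m).map (Z a) := by
  simp [arrayStream, List.range_succ, List.flatMap_append]

theorem rowStream_eq_arrayStream {a m : ℕ} (Z : Matrix (Fin a) (Fin m) ℝ) (Z' : ℕ → ℕ → ℝ)
    (h : ∀ i c, Z i c = Z' i c) : rowStream Z = arrayStream a m Z' := by
  have h1 : ∀ i : Fin a, List.ofFn (Z i) = (List.range m).map (Z' i) := by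
    intro i
    rw [← List.map_coe_finRange_eq_range, List.map_map, List.ofFn_eq_map]
    exact List.map_congr_left fun c _ => h i c
  unfold rowStream arrayStream
  have h2 : List.range a = (List.finRange a).map fun x : Fin a => (x : ℕ) :=
    List.map_coe_finRange_eq_range.symm
  rw [h2, List.flatMap_map]
  exact List.flatMap_congr fun i _ => h1 i

namespace FilterBank

variable (F : FilterBank)

/-- The program of a level: it adds the output of its own filters to the partial output of the
enclosing level and passes the sum on to the program of the preceding level. -/
noncomputable def levelProg (m p : ℕ) : ℕ → Prog
  | 0 => .seq (F.reset m 0) <| .seq (.const (rCtr 0) p) <| .whilePos (rCtr 0) <|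
      .seq (F.readRow m 0) <| .seq (F.computeVals m 0) <| .seq (writeVals m 0) (decrement 0)
  | l + 1 => .seq (F.reset m (l + 1)) <| .seq (.const (rCtr (l + 1)) p) <|
      .whilePos (rCtr (l + 1)) <| .seq (F.computeVals m (l + 1)) <|
      .seq (levelProg m p l) <| .seq (F.readRow m (l + 1)) (decrement (l + 1))

/-- A bound for the running time of `levelProg`. -/
def levelTime (m p : ℕ) : ℕ → ℕ
  | 0 => (m * (F.size * 1 + 1) + 1) + (1 + (p * ((m * (F.size * 8 + 2) + 1) +
      ((m * (F.size * 3 + 3) + 1) + ((m * 1 + 1) + 2)) + 1) + 1))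
  | l + 1 => (m * (F.size * 1 + 1) + 1) + (1 + (p * ((m * (F.size * 3 + 3) + 1) +
      (levelTime m p l + ((m * (F.size * 8 + 2) + 1) + 2)) + 1) + 1))

/-- The filters of level `l` have been fed with the first `i` rows of `Z`. -/
def HasState (m l i : ℕ) (Z : ℕ → ℕ → ℝ) (ρ : ℕ → ℝ) : Prop :=
  ∀ c < m, ∀ a < F.size, ρ (rBuf l c a) =
    ∑ j ∈ range i, impulse F.decay F.coupling F.gain (i - 1 - j) a * Z j c

variable {F}

/-- One filter step ages every earlier impulse by one, which is the recursion defining `impulse`,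
and the new row enters with the response at time 0, the gain. -/
theorem HasState.step {m l i : ℕ} {Z : ℕ → ℕ → ℝ} {ρ ρ' : ℕ → ℝ} (h : F.HasState m l i Z ρ)
    (h' : ∀ c < m, ∀ a < F.size, ρ' (rBuf l c a) = F.decay a * ρ (rBuf l c a) +
        F.coupling a * ρ (rBuf l c (a - 1)) + F.gain a * Z i c) :
    F.HasState m l (i + 1) Z ρ' := by
  intro c hc a ha
  rw [h' c hc a ha, h c hc a ha, h c hc (a - 1) (by omega), sum_range_succ, mul_sum, mul_sum,
    ← sum_add_distrib, Nat.add_sub_cancel, Nat.sub_self, impulse]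
  congr 1
  refine sum_congr rfl fun j hj => ?_
  rw [mem_range] at hj
  rw [show i - j = (i - 1 - j) + 1 by omega, impulse]
  ring

theorem HasState.output {m l i : ℕ} {Z : ℕ → ℕ → ℝ} {ρ : ℕ → ℝ} (h : F.HasState m l i Z ρ)
    {b : PowerSeries ℝ} (hb : ∀ i, b.coeff i = ∑ a ∈ range F.size, F.weight a *
      impulse F.decay F.coupling F.gain i a) {c : ℕ} (hc : c < m) :
    ∑ a ∈ range F.size, F.weight a * ρ (rBuf l c a) =
      ∑ j ∈ range i, b.coeff (i - 1 - j) * Z j c := by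
  rw [sum_congr rfl fun a ha => by rw [h c hc a (mem_range.1 ha), mul_sum], sum_comm]
  refine sum_congr rfl fun j _ => ?_
  rw [hb, sum_mul]
  exact sum_congr rfl fun a _ => by ring

theorem HasState.congr {m l i : ℕ} {Z : ℕ → ℕ → ℝ} {ρ ρ' : ℕ → ℝ} (h : F.HasState m l i Z ρ)
    (h' : ∀ c a, ρ' (rBuf l c a) = ρ (rBuf l c a)) : F.HasState m l i Z ρ' := by
  intro c hc a ha
  rw [h', h c hc a ha]

theorem ne_of_regLevel {x y : ℕ} (h : regLevel x ≠ regLevel y) : x ≠ y :=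
  fun hxy => h (by rw [hxy])

theorem sum_leftFactor_zero_mul (b : PowerSeries ℝ) {p i : ℕ} (hi : i < p) (z : ℕ → ℝ) :
    ∑ j ∈ range (levelCols p 0), leftFactor b p 0 i j * z j =
      ∑ j ∈ range (i + 1), b.coeff (i + 1 - 1 - j) * z j := by
  symm
  refine sum_subset_zero_on_sdiff (range_mono hi) (fun j hj => ?_) (fun j hj => ?_)
  · rw [mem_sdiff, mem_range, mem_range] at hj
    rw [leftFactor, if_neg hj.2, zero_mul]
  · rw [leftFactor, if_pos (mem_range.1 hj)]

theorem sum_leftFactor_succ_mul (b : PowerSeries ℝ) {p l i i' : ℕ} (hi : i < p)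
    (hi' : i' < levelRows p l) (z : ℕ → ℝ) :
    ∑ j ∈ range (levelCols p (l + 1)), leftFactor b p (l + 1) (i * levelRows p l + i') j * z j =
      ∑ j ∈ range i, b.coeff (i - 1 - j) * z (j * (levelCols p l + 1) + levelCols p l) +
      ∑ r ∈ range (levelCols p l), leftFactor b p l i' r * z (i * (levelCols p l + 1) + r) := by
  rw [sum_levelCols_succ, add_comm]
  simp only [leftFactor_succ_last, block_div hi']
  congr 1
  · symm
    refine sum_subset_zero_on_sdiff (range_mono hi.le) (fun j hj => ?_) (fun j hj => ?_)
    · rw [mem_sdiff, mem_range, mem_range] at hj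
      rw [if_neg hj.2, zero_mul]
    · rw [if_pos (mem_range.1 hj)]
  · rw [sum_eq_single i]
    · refine sum_congr rfl fun r hr => ?_
      rw [leftFactor_succ_inner _ _ _ _ _ _ (mem_range.1 hr), block_div hi', block_mod hi',
        if_pos rfl]
    · intro j _ hj
      refine sum_eq_zero fun r hr => ?_
      rw [leftFactor_succ_inner _ _ _ _ _ _ (mem_range.1 hr), block_div hi', if_neg hj, zero_mul]
    · intro h
      exact absurd (mem_range.2 hi) h

theorem wp_levelProg_zero {b : PowerSeries ℝ} (hb : ∀ i, b.coeff i = ∑ a ∈ range F.size,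
      F.weight a * impulse F.decay F.coupling F.gain i a) (m p : ℕ)
    (Z : ℕ → ℕ → ℝ) (ρ : ℕ → ℝ) :
    WP (F.levelProg m p 0) ρ (arrayStream (levelCols p 0) m Z)
      (arrayStream (levelRows p 0) m fun i c => ρ (rVal 1 c) +
        ∑ j ∈ range (levelCols p 0), leftFactor b p 0 i j * Z j c)
      (F.levelTime m p 0) fun ρ' => ∀ x, 0 < regLevel x → ρ' x = ρ x := by
  refine WP.of_eq (List.nil_append _) (List.nil_append _) <| WP.seq <|
      (F.wp_reset m 0 ρ).mono le_rfl fun ρ₁ h => ?_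
  obtain ⟨h1, h2⟩ := h
  refine WP.of_eq (List.nil_append _) (List.nil_append _) <| WP.seq <| WP.const ?_
  refine (WP.whilePos p (fun i ρ' => F.HasState m 0 i Z ρ' ∧ ρ' (rCtr 0) = (p : ℝ) - i ∧
    ∀ x, 0 < regLevel x → ρ' x = ρ x) (fun i => (List.range m).map (Z i))
    (fun i => (List.range m).map fun c => ρ (rVal 1 c) +
      ∑ j ∈ range (levelCols p 0), leftFactor b p 0 i j * Z j c) (fun i hi ρ₂ h => ?_)
    (fun ρ₂ h => by rw [h.2.1, sub_self]) ?_).mono le_rfl fun ρ' h => h.2.2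
  · obtain ⟨h3, h4, h5⟩ := h
    have hip : (i : ℝ) < p := by exact_mod_cast hi
    refine ⟨by rw [h4]; linarith, ?_⟩
    have e1 : (List.range m).map (Z i) = (List.range m).map (Z i) ++ ([] ++ ([] ++ [])) := by simp
    have e2 : ∀ L : List ℝ, L = [] ++ ([] ++ (L ++ [])) := by simp
    rw [e1, e2 ((List.range m).map fun c => ρ (rVal 1 c) +
      ∑ j ∈ range (levelCols p 0), leftFactor b p 0 i j * Z j c)]
    refine WP.seq <| (F.wp_readRow m 0 ρ₂ (Z i)).mono le_rfl fun ρ₃ h => ?_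
    obtain ⟨h6, h7⟩ := h
    refine WP.seq <| (F.wp_computeVals m 0 ρ₃).mono le_rfl fun ρ₄ h => ?_
    obtain ⟨h8, h9⟩ := h
    -- At level 0 the row is read before the output is formed, so i + 1 rows count and the diagonal
    -- is included. Higher levels read their row only after the block, so there only completed
    -- blocks count.
    have hS : F.HasState m 0 (i + 1) Z ρ₃ := h3.step h6
    have hv : (List.range m).map (fun c => ρ (rVal 1 c) +
        ∑ j ∈ range (levelCols p 0), leftFactor b p 0 i j * Z j c) =
        (List.range m).map fun c => ρ₄ (rVal 0 c) := by
      refine List.map_congr_left fun c hc => ?_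
      rw [List.mem_range] at hc
      rw [h8 c hc, hS.output hb hc, sum_leftFactor_zero_mul b hi fun j => Z j c,
        h7 _ (by simp [reg_inj]) (by simp [reg_inj]) (by simp [reg_inj]),
        h5 _ (by simp [regLevel_reg])]
    rw [hv]
    refine WP.seq <| (wp_writeVals m 0 ρ₄).mono le_rfl fun ρ₅ h => ?_
    subst h
    refine (wp_decrement 0 ρ₅).mono le_rfl fun ρ₆ h => ?_
    obtain ⟨h10, h11⟩ := h
    refine ⟨hS.congr fun c a => ?_, ?_, fun x hx => ?_⟩
    · rw [h11 _ (by simp [reg_inj]) (by simp [reg_inj]),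
        h9 _ (by simp [reg_inj]) (by simp [reg_inj])]
    · rw [h10, h9 _ (by simp [reg_inj]) (by simp [reg_inj]),
        h7 _ (by simp [reg_inj]) (by simp [reg_inj]) (by simp [reg_inj]), h4]
      push_cast
      ring
    · have hne : ∀ k c a, x ≠ reg 0 k c a := fun k c a =>
        ne_of_regLevel (by rw [regLevel_reg]; omega)
      rw [h11 x (hne _ _ _) (hne _ _ _), h9 x (hne _ _ _) fun c => hne _ _ _,
        h7 x (hne _ _ _) (hne _ _ _) fun c a => hne _ _ _, h5 x hx]
  · refine ⟨fun c hc a ha => ?_, by simp, fun x hx => ?_⟩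
    · rw [Function.update_of_ne (by simp [reg_inj]), h1 c hc a ha]
      simp
    · have hne : ∀ k c a, x ≠ reg 0 k c a := fun k c a =>
        ne_of_regLevel (by rw [regLevel_reg]; omega)
      rw [Function.update_of_ne (hne _ _ _), h2 x fun c a => hne _ _ _]

/-- The value registers of level l + 1 act as an offset added to every output row, so the induction
must allow arbitrary ρ. Leaving registers of higher levels untouched protects the filters and loop
counters of the enclosing loops. -/
theorem wp_levelProg {b : PowerSeries ℝ} (hb : ∀ i, b.coeff i = ∑ a ∈ range F.size,
      F.weight a * impulse F.decay F.coupling F.gain i a) (m p l : ℕ)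
    (Z : ℕ → ℕ → ℝ) (ρ : ℕ → ℝ) :
    WP (F.levelProg m p l) ρ (arrayStream (levelCols p l) m Z)
      (arrayStream (levelRows p l) m fun i c => ρ (rVal (l + 1) c) +
        ∑ j ∈ range (levelCols p l), leftFactor b p l i j * Z j c)
      (F.levelTime m p l) fun ρ' => ∀ x, l < regLevel x → ρ' x = ρ x := by
  induction l generalizing Z ρ with
  | zero => exact wp_levelProg_zero hb m p Z ρ
  | succ l ih =>
    set k := levelCols p l with hk
    refine WP.of_eq (List.nil_append _) (List.nil_append _) <| WP.seq <|
      (F.wp_reset m (l + 1) ρ).mono le_rfl fun ρ₁ h => ?_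
    obtain ⟨h1, h2⟩ := h
    refine WP.of_eq (List.nil_append _) (List.nil_append _) <| WP.seq <| WP.const ?_
    rw [levelCols, levelRows, arrayStream_mul, arrayStream_mul]
    refine (WP.whilePos p (fun i ρ' => F.HasState m (l + 1) i (fun j => Z (j * (k + 1) + k)) ρ' ∧
      ρ' (rCtr (l + 1)) = (p : ℝ) - i ∧ ∀ x, l + 1 < regLevel x → ρ' x = ρ x) _ _
      (fun i hi ρ₂ h => ?_) (fun ρ₂ h => by rw [h.2.1, sub_self]) ?_).mono le_rfl
        fun ρ' h => h.2.2
    · obtain ⟨h3, h4, h5⟩ := h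
      have hip : (i : ℝ) < p := by exact_mod_cast hi
      refine ⟨by rw [h4]; linarith, ?_⟩
      rw [arrayStream_succ, ← hk]
      have e1 : ∀ L L' : List ℝ, L ++ L' = [] ++ (L ++ (L' ++ [])) := by simp
      have e2 : ∀ L : List ℝ, L = [] ++ (L ++ ([] ++ [])) := by simp
      rw [e1, e2 (arrayStream (levelRows p l) m _)]
      refine WP.seq <| (F.wp_computeVals m (l + 1) ρ₂).mono le_rfl fun ρ₃ h => ?_
      obtain ⟨h6, h7⟩ := h
      -- The contribution of the completed blocks is constant within a block, so it can be computed
      -- once and handed to the inner program as its offset.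
      have hout : (arrayStream (levelRows p l) m fun i' c => ρ (rVal (l + 1 + 1) c) +
          ∑ j ∈ range (p * (k + 1)), leftFactor b p (l + 1) (i * levelRows p l + i') j * Z j c) =
          arrayStream (levelRows p l) m fun i' c => ρ₃ (rVal (l + 1) c) +
            ∑ r ∈ range k, leftFactor b p l i' r * Z (i * (k + 1) + r) c := by
        refine arrayStream_congr fun i' hi' c hc => ?_
        have := sum_leftFactor_succ_mul b hi hi' fun j => Z j c
        rw [levelCols, ← hk] at this
        rw [this, h6 c hc, h3.output hb hc, h5 _ (by simp [regLevel_reg]), ← add_assoc]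
      rw [hout]
      refine WP.seq <| (ih (fun r => Z (i * (k + 1) + r)) ρ₃).mono le_rfl fun ρ₄ h8 => ?_
      refine WP.seq <| (F.wp_readRow m (l + 1) ρ₄ (Z (i * (k + 1) + k))).mono le_rfl fun ρ₅ h => ?_
      obtain ⟨h9, h10⟩ := h
      refine (wp_decrement (l + 1) ρ₅).mono le_rfl fun ρ₆ h => ?_
      obtain ⟨h11, h12⟩ := h
      have hS : F.HasState m (l + 1) i (fun j => Z (j * (k + 1) + k)) ρ₄ := h3.congr fun c a => by
        rw [h8 _ (by simp [regLevel_reg]), h7 _ (by simp [reg_inj]) (by simp [reg_inj])]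
      refine ⟨(hS.step h9).congr fun c a => ?_, ?_, fun x hx => ?_⟩
      · rw [h12 _ (by simp [reg_inj]) (by simp [reg_inj])]
      · rw [h11, h10 _ (by simp [reg_inj]) (by simp [reg_inj]) (by simp [reg_inj]),
          h8 _ (by simp [regLevel_reg]), h7 _ (by simp [reg_inj]) (by simp [reg_inj]), h4]
        push_cast
        ring
      · have hne : ∀ l' k c a, l' ≤ l + 1 → x ≠ reg l' k c a := fun l' k c a hl =>
          ne_of_regLevel (by rw [regLevel_reg]; omega)
        rw [h12 x (hne _ _ _ _ (by omega)) (hne _ _ _ _ (by omega)),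
          h10 x (hne _ _ _ _ (by omega)) (hne _ _ _ _ (by omega))
            fun c a => hne _ _ _ _ (by omega), h8 x (by omega),
          h7 x (hne _ _ _ _ (by omega)) fun c => hne _ _ _ _ (by omega), h5 x hx]
    · refine ⟨fun c hc a ha => ?_, by simp, fun x hx => ?_⟩
      · rw [Function.update_of_ne (by simp [reg_inj]), h1 c hc a ha]
        simp
      · have hne : ∀ k c a, x ≠ reg (l + 1) k c a := fun k c a =>
          ne_of_regLevel (by rw [regLevel_reg]; omega)
        rw [Function.update_of_ne (hne _ _ _), h2 x fun c a => hne _ _ _]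

variable (F)

/-- The surplus 30D, where D = m(size + 1), makes the induction close: each of the p ≥ 3 inner runs
returns 30D, which pays 16D of work per block and still leaves 14pD ≥ 42D for initialization and the
new surplus. -/
theorem levelTime_add_le {m p : ℕ} (hm : 1 ≤ m) (hp : 3 ≤ p) (l : ℕ) :
    F.levelTime m p l + 30 * (m * (F.size + 1)) ≤ 34 * (m * (F.size + 1)) * levelRows p l := by
  obtain ⟨D, hD⟩ : ∃ D, D = m * (F.size + 1) := ⟨_, rfl⟩
  have hD1 : m * F.size + m = D := by rw [hD]; ring
  rw [← hD]
  induction l with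
  | zero =>
    have h1 : (m * (F.size * 8 + 2) + 1) + ((m * (F.size * 3 + 3) + 1) + ((m * 1 + 1) + 2)) + 1
        ≤ 17 * D := by nlinarith
    have h2 := Nat.mul_le_mul_left p h1
    simp only [levelTime, levelRows]
    nlinarith
  | succ l ih =>
    have h1 : (m * (F.size * 3 + 3) + 1) +
        (F.levelTime m p l + ((m * (F.size * 8 + 2) + 1) + 2)) + 1 ≤ 16 * D + F.levelTime m p l := by
      nlinarith
    have h2 := Nat.mul_le_mul_left p h1
    have h3 := Nat.mul_le_mul_left p ih
    have h4 := Nat.mul_le_mul_right D hp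
    simp only [levelTime, levelRows]
    nlinarith

theorem length_readRow_le (m l : ℕ) :
    (F.readRow m l).length ≤ m * (F.size * 16 + 4) + 1 := by
  refine (length_seqUp_le m _ (F.size * 16 + 3) fun c => ?_).trans (le_of_eq (by ring))
  have := length_seqUp_le F.size (fun k => F.updateFilter l c (F.size - 1 - k)) 15 fun k => by
    simp [updateFilter, Prog.length]
  simp only [Prog.length, updateColumn]
  omega

theorem length_computeVals_le (m l : ℕ) :
    (F.computeVals m l).length ≤ m * (F.size * 6 + 6) + 1 := by
  refine (length_seqUp_le m _ (F.size * 6 + 5) fun c => ?_).trans (le_of_eq (by ring))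
  have := length_seqUp_le F.size (fun a => .seq (.const rTmp (F.weight a)) <|
    .seq (.mul rTmp rTmp (rBuf l c a)) (.add (rVal l c) (rVal l c) rTmp)) 5 fun k => by
      simp [Prog.length]
  simp only [Prog.length, computeVal]
  omega

theorem length_reset_le (m l : ℕ) : (F.reset m l).length ≤ m * (F.size * 2 + 2) + 1 := by
  refine (length_seqUp_le m _ (F.size * 2 + 1) fun c => ?_).trans (le_of_eq (by ring))
  exact length_seqUp_le F.size _ 1 fun k => by simp [Prog.length]

theorem length_writeVals_le (m l : ℕ) : (writeVals m l).length ≤ m * 2 + 1 :=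
  length_seqUp_le m _ 1 fun c => by simp [Prog.length]

theorem length_levelProg_le {m : ℕ} (hm : 1 ≤ m) (p l : ℕ) :
    (F.levelProg m p l).length ≤ 60 * (m * (F.size + 1)) * (l + 1) := by
  obtain ⟨D, hD⟩ : ∃ D, D = m * (F.size + 1) := ⟨_, rfl⟩
  have hD1 : m * F.size + m = D := by rw [hD]; ring
  rw [← hD]
  have hdec : ∀ l, (decrement l).length = 3 := fun l => by simp [decrement, Prog.length]
  induction l with
  | zero =>
    have h1 := F.length_readRow_le m 0
    have h2 := F.length_computeVals_le m 0
    have h3 := F.length_reset_le m 0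
    have h4 := length_writeVals_le m 0
    simp only [levelProg, Prog.length, hdec]
    nlinarith
  | succ l ih =>
    have h1 := F.length_readRow_le m (l + 1)
    have h2 := F.length_computeVals_le m (l + 1)
    have h3 := F.length_reset_le m (l + 1)
    simp only [levelProg, Prog.length, hdec]
    nlinarith

end FilterBank

/-! ### Assembling the result -/

theorem levelRows_eq (p l : ℕ) : levelRows p l = p ^ (l + 1) := by
  induction l with
  | zero => simp [levelRows]
  | succ l ih => rw [levelRows, ih, pow_succ' p (l + 1)]

theorem levelCols_eq {p : ℕ} (hp : 2 ≤ p) (l : ℕ) :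
    levelCols p l = (p ^ (l + 1 + 1) - p) / (p - 1) := by
  obtain ⟨q, rfl⟩ := Nat.exists_eq_add_of_le' (by omega : 1 ≤ p)
  have h : levelCols (q + 1) l * q + (q + 1) = (q + 1) ^ (l + 1 + 1) := by
    induction l with
    | zero => simp only [levelCols]; ring
    | succ l ih =>
      rw [pow_succ' _ (l + 1 + 1), ← ih, levelCols]
      ring
  rw [← h, Nat.add_sub_cancel, Nat.add_sub_cancel, Nat.mul_div_cancel _ (by omega)]

theorem optLTToe_eq_Icc (n : ℕ) (hn : 1 ≤ n) : optLTToe n =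
    1 + ∑ i ∈ Icc 1 (n - 1), ((2 : ℝ)⁻¹ ^ (2 * i) * ((2 * i).choose i : ℝ)) ^ 2 := by
  obtain ⟨k, rfl⟩ := Nat.exists_eq_add_of_le' hn
  rw [optLTToe_succ, sum_range_succ', invSqrtCoeff_zero, Nat.add_sub_cancel, add_comm, one_pow,
    show Icc 1 k = Ico 1 (k + 1) by rfl, sum_Ico_eq_sum_range]
  congr 1
  refine sum_congr (by simp) fun i _ => ?_
  rw [add_comm 1 i, pow_mul, invSqrtCoeff, Nat.centralBinom]
  congr 1
  rw [div_eq_inv_mul, ← inv_pow]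
  norm_num

theorem produces_levelProg {F : FilterBank} {b : PowerSeries ℝ}
    (hb : ∀ i, b.coeff i = ∑ a ∈ range F.size,
      F.weight a * impulse F.decay F.coupling F.gain i a) {m p : ℕ} (hm : 1 ≤ m) (hp : 3 ≤ p)
    (l : ℕ) (Z : Matrix (Fin (levelCols p l)) (Fin m) ℝ) :
    (F.levelProg m p l).Produces (rowStream Z)
      (rowStream ((Matrix.of fun (i : Fin (levelRows p l)) (j : Fin (levelCols p l)) =>
        leftFactor b p l i j) * Z)) (34 * (m * (F.size + 1)) * levelRows p l) := by
  set Z' : ℕ → ℕ → ℝ := fun i c =>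
    if h : i < levelCols p l ∧ c < m then Z ⟨i, h.1⟩ ⟨c, h.2⟩ else 0 with hZ'
  have hZ : ∀ i c, Z i c = Z' i c := fun i c => by simp [hZ']
  obtain ⟨ρ', t, ht, -, he⟩ := FilterBank.wp_levelProg hb m p l Z' fun _ => 0
  refine ⟨ρ', t, ht.trans ((Nat.le_add_right _ _).trans (F.levelTime_add_le hm hp l)), ?_⟩
  rw [rowStream_eq_arrayStream Z Z' hZ, rowStream_eq_arrayStream _ (fun i c => 0 +
    ∑ j ∈ range (levelCols p l), leftFactor b p l i j * Z' j c)]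
  · simpa using he [] []
  · intro i c
    rw [zero_add, Matrix.mul_apply, ← Fin.sum_univ_eq_sum_range fun j =>
      leftFactor b p l i j * Z' j c]
    refine sum_congr rfl fun j _ => ?_
    rw [hZ]
    rfl

theorem space_levelProg_le (F : FilterBank) {m : ℕ} (hm : 1 ≤ m) (p l : ℕ) :
    (F.levelProg m p l).space ≤ 240 * (m * (F.size + 1)) * (l + 1) := by
  have h1 := F.length_levelProg_le hm p l
  have h2 := card_registers_le (F.levelProg m p l)
  unfold Prog.space
  nlinarith

theorem factorization_matrices {b c : PowerSeries ℝ} (hbc : b * c = onesSeries) {p : ℕ}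
    (hp : 0 < p) (l : ℕ) :
    (Matrix.of fun (i : Fin (levelRows p l)) (j : Fin (levelCols p l)) => leftFactor b p l i j) *
      (Matrix.of fun (j : Fin (levelCols p l)) (i : Fin (levelRows p l)) => rightFactor c p l j i) =
      allOnes (levelRows p l) := by
  ext i i'
  rw [Matrix.mul_apply]
  simp only [Matrix.of_apply]
  rw [Fin.sum_univ_eq_sum_range fun j => leftFactor b p l i j * rightFactor c p l j i',
    sum_leftFactor_mul_rightFactor hbc hp l i i' i.2 i'.2]
  simp [allOnes]

theorem maxErr_factorization_le (b c : PowerSeries ℝ) {p : ℕ} (hp : 0 < p) (l : ℕ) :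
    maxErr
      (Matrix.of fun (i : Fin (levelRows p l)) (j : Fin (levelCols p l)) => leftFactor b p l i j)
      (Matrix.of fun (j : Fin (levelCols p l)) (i : Fin (levelRows p l)) => rightFactor c p l j i) ≤
      (l + 1 : ℕ) * (√(l2NormSq p b) * √(l2NormSq p c)) := by
  have hpos := levelRows_pos hp l
  refine (maxErr_le hpos hpos _ _ ((l + 1 : ℕ) * l2NormSq p b) ((l + 1 : ℕ) * l2NormSq p c)
    (fun i => ?_) fun i => ?_).trans (le_of_eq ?_)
  · simp only [Matrix.of_apply]
    rw [Fin.sum_univ_eq_sum_range fun j => leftFactor b p l i j ^ 2]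
    exact leftFactor_row_sq_le b hp l i i.2
  · simp only [Matrix.of_apply]
    rw [Fin.sum_univ_eq_sum_range fun j => rightFactor c p l j i ^ 2]
    exact rightFactor_col_sq_le c hp l i i.2
  · have h0 : (0 : ℝ) ≤ (l + 1 : ℕ) := Nat.cast_nonneg _
    rw [Real.sqrt_mul h0, Real.sqrt_mul h0]
    linear_combination (√(l2NormSq p b) * √(l2NormSq p c)) * Real.mul_self_sqrt h0

end ContinualCounting

theorem mainTheorem7 :
    ∃ K : ℕ, ∀ m l n₁ d n k : ℕ, 1 ≤ m → 1 ≤ l → 5 ≤ n₁ →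
      2 + ((12 + 4 * Real.log (n₁ : ℝ)) / Real.pi) ^ 2 ≤ (d : ℝ) →
      n = n₁ ^ l → k = (n₁ ^ (l + 1) - n₁) / (n₁ - 1) →
      ∃ (B : Matrix (Fin n) (Fin k) ℝ) (C : Matrix (Fin k) (Fin n) ℝ)
        (P : ContinualCounting.Prog) (σ : Equiv.Perm (Fin k)),
        -- valid matrix factorization
        B * C = ContinualCounting.allOnes n ∧
        -- near-optimality
        ContinualCounting.maxErr B C ≤
          (l : ℝ) * (√(ContinualCounting.optLTToe n₁) +
            16 * √(n₁ : ℝ) * Real.exp (-(Real.pi / 2) * √((d : ℝ) - 2))) ^ 2 ∧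
        ContinualCounting.optLTToe n₁ =
          1 + ∑ i ∈ Finset.Icc 1 (n₁ - 1), ((2 : ℝ)⁻¹ ^ (2 * i) * ((2 * i).choose i : ℝ)) ^ 2 ∧
        ContinualCounting.optLTToe n₁ ≤ 1 + (0.57722 + Real.log (n₁ : ℝ)) / Real.pi ∧
        -- valid algorithm, with the total running time
        (∀ Z : Matrix (Fin k) (Fin m) ℝ,
          P.Produces (ContinualCounting.rowStream (Z.submatrix σ id))
            (ContinualCounting.rowStream (B * Z)) (K * (n * d * m))) ∧
        -- space
        P.space ≤ K * (l * d * m) := by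
  -- With m(N + 1) ≤ 241dm, the time constant is 34 · 241 = 8194 and the space constant 240 · 241 =
  -- 57840.
  refine ⟨60000, fun m l n₁ d n k hm hl hn₁ hd hn hk => ?_⟩
  obtain ⟨l, rfl⟩ := Nat.exists_eq_add_of_le' hl
  rw [← ContinualCounting.levelRows_eq] at hn
  rw [← ContinualCounting.levelCols_eq (by omega)] at hk
  subst hn hk
  obtain ⟨N, θ, κ, ι, w, b, c, hN, hκ, hb, hbc, herr⟩ :=
    ContinualCounting.exists_filter_bank_factorization n₁ d (by omega) hd
  have hp : 0 < n₁ := by omega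
  have hd1 : 1 ≤ d := by
    have h2 : (1 : ℝ) ≤ d := le_trans
      (by linarith [sq_nonneg ((12 + 4 * Real.log (n₁ : ℝ)) / Real.pi)]) hd
    exact_mod_cast h2
  have hmN : m * (N + 1) ≤ 241 * (d * m) := by nlinarith
  -- Each block's own column follows its inner columns, which is the order in which the program
  -- reads, so the identity permutation suffices.
  refine ⟨_, _, ContinualCounting.FilterBank.levelProg ⟨N, θ, κ, ι, w, hκ⟩ m n₁ l,
    Equiv.refl _, ContinualCounting.factorization_matrices hbc hp l,
    (ContinualCounting.maxErr_factorization_le b c hp l).trans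
      (mul_le_mul_of_nonneg_left herr (Nat.cast_nonneg _)),
    ContinualCounting.optLTToe_eq_Icc n₁ (by omega), ?_, fun Z => ?_, ?_⟩
  · obtain ⟨q, rfl⟩ := Nat.exists_eq_add_of_le' (by omega : 1 ≤ n₁)
    rw [ContinualCounting.optLTToe_succ]
    exact ContinualCounting.sum_invSqrtCoeff_sq_le _ (by omega)
  · obtain ⟨ρ', t, ht, he⟩ := ContinualCounting.produces_levelProg
      (F := ⟨N, θ, κ, ι, w, hκ⟩) hb hm (by omega : 3 ≤ n₁) l Z
    refine ⟨ρ', t, ht.trans ?_, he⟩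
    have h2 := Nat.mul_le_mul_right (ContinualCounting.levelRows n₁ l)
      (Nat.mul_le_mul_left 34 hmN)
    refine h2.trans ?_
    have h3 : 34 * (241 * (d * m)) * ContinualCounting.levelRows n₁ l =
        8194 * (ContinualCounting.levelRows n₁ l * d * m) := by ring
    rw [h3]
    exact Nat.mul_le_mul_right _ (by norm_num)
  · refine (ContinualCounting.space_levelProg_le ⟨N, θ, κ, ι, w, hκ⟩ hm n₁ l).trans ?_
    have h2 := Nat.mul_le_mul_right (l + 1) (Nat.mul_le_mul_left 240 hmN)
    refine h2.trans ?_
    have h3 : 240 * (241 * (d * m)) * (l + 1) = 57840 * ((l + 1) * d * m) := by ring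
    rw [h3]
    exact Nat.mul_le_mul_right _ (by norm_num)
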